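/- Theorem 1. For finite-dimensional Hilbert spaces $X,Y$ let $\mathrm{LOCC}(X,Y)$ be the set of completely positive, trace-nonincreasing superoperators on $X\otimes Y$ that are implemented by local operations on $X$ and on $Y$ (with local ancillas) coordinated by finitely many rounds of two-way classical communication, where branches of the protocol may be rejected. For a two-qubit density operator $\rho$ let $f(\rho)=\max_{\Lambda\in\mathrm{LOCC}(B,C)}\langle\Phi|\Lambda(\rho)|\Phi\rangle$ with $|\Phi\rangle=\frac{1}{\sqrt2}(|00\rangle+|11\rangle)$. Let $A,B,C$ be qubits, and define the optimal sampling overhead for cutting a single-qubit wire from $A$ to $C$ with LOCC between the sender $A\otimes B$ and the receiver $C$, assisted by the resource state $\rho_{BC}$, as $$\gamma^{\rho}(\mathcal I)=\min\Bigl\{\sum_i|c_i| \;\Big|\; \mathcal V=\sum_i c_i\mathcal F_i \text{ (a finite sum)},\ c_i\in\mathbb R,\ \mathcal F_i\in\mathrm{LOCC}(A\otimes B,C),\ \operatorname{Tr}_{AB}[\mathcal V(\varphi\otimes\rho_{BC})]=\varphi \text{ for every density operator } \varphi \text{ on } A\Bigr\}.$$ Then, for every two-qubit density operator $\rho$, the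 maximum and the minimum above are attained, and $$\gamma^{\rho}(\mathcal I)=\frac{2}{f(\rho)}-1 .$$ -/

import Mathlib

open scoped Matrix Kronecker ComplexOrder

noncomputable section

namespace WireCut

/-- Operators on a finite-dimensional Hilbert space with orthonormal basis indexed by `a`. -/
abbrev Op (a : Type) : Type := Matrix a a ℂ

/-- Superoperators from operators on `a` to operators on `a'`. -/
abbrev SuperOp (a a' : Type) : Type := Op a →ₗ[ℂ] Op a'

/-- Density operators: positive semidefinite with unit trace. -/
def IsDensity {a : Type} [Fintype a] (ρ : Op a) : Prop :=
  ρ.PosSemidef ∧ ρ.trace = 1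

/-- The map `M ↦ K M K†`. -/
def conjBy {a x : Type} [Fintype a] (K : Matrix x a ℂ) : SuperOp a x where
  toFun M := K * M * Kᴴ
  map_add' M N := by rw [Matrix.mul_add, Matrix.add_mul]
  map_smul' c M := by simp

/-- `IsLOCC a' b' a b Λ`: the superoperator `Λ`, from operators on `a ⊗ b` to operators on
`a' ⊗ b'`, is implemented by local operations of the two parties (the first one holding `a`, the
second one `b`) and finitely many rounds of two-way classical communication. In each round one
party performs a measurement on its own system, with Kraus operators `K i`, and broadcasts the
outcome `i`; the rest of the protocol may depend on it. The system of a party may change its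
dimension on the way (local ancillas, discarding). A branch may be rejected (`fail`), so that `Λ`
is completely positive and trace-nonincreasing, a coarse-graining of some of the branches of a
complete LOCC instrument; without `fail`, `Λ` is trace-preserving. -/
inductive IsLOCC (a' b' : Type) :
    (a b : Type) → [Fintype a] → [DecidableEq a] → [Fintype b] → [DecidableEq b] →
      SuperOp (a × b) (a' × b') → Prop
  | done [Fintype a'] [DecidableEq a'] [Fintype b'] [DecidableEq b'] :
      IsLOCC a' b' a' b' LinearMap.id
  | fail (a b : Type) [Fintype a] [DecidableEq a] [Fintype b] [DecidableEq b] :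
      IsLOCC a' b' a b 0
  | left (a b x : Type) [Fintype a] [DecidableEq a] [Fintype b] [DecidableEq b]
      [Fintype x] [DecidableEq x] (m : ℕ) (K : Fin m → Matrix x a ℂ)
      (hK : ∑ i, (K i)ᴴ * K i = 1) (Λ : Fin m → SuperOp (x × b) (a' × b'))
      (hΛ : ∀ i, IsLOCC a' b' x b (Λ i)) :
      IsLOCC a' b' a b (∑ i, Λ i ∘ₗ conjBy (K i ⊗ₖ (1 : Matrix b b ℂ)))
  | right (a b x : Type) [Fintype a] [DecidableEq a] [Fintype b] [DecidableEq b]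
      [Fintype x] [DecidableEq x] (m : ℕ) (K : Fin m → Matrix x b ℂ)
      (hK : ∑ i, (K i)ᴴ * K i = 1) (Λ : Fin m → SuperOp (a × x) (a' × b'))
      (hΛ : ∀ i, IsLOCC a' b' a x (Λ i)) :
      IsLOCC a' b' a b (∑ i, Λ i ∘ₗ conjBy ((1 : Matrix a a ℂ) ⊗ₖ K i))

/-- The set `LOCC(A, B)` of LOCC superoperators on `A ⊗ B`. -/
def LOCC (a b : Type) [Fintype a] [DecidableEq a] [Fintype b] [DecidableEq b] :
    Set (SuperOp (a × b) (a × b)) :=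
  {Λ | IsLOCC a b a b Λ}

/-- A qubit. -/
abbrev Qubit : Type := Fin 2

/-- The Bell vector `(|00⟩ + |11⟩) / √2`. -/
def bell : Qubit × Qubit → ℂ :=
  fun p => if p.1 = p.2 then ((1 / Real.sqrt 2 : ℝ) : ℂ) else 0

/-- The overlap `⟨Φ|σ|Φ⟩` with the Bell state. -/
def overlap (σ : Op (Qubit × Qubit)) : ℝ :=
  (star bell ⬝ᵥ (σ *ᵥ bell)).re

/-- The overlaps with the Bell state that LOCC can reach from `ρ`. -/
def overlapValues (ρ : Op (Qubit × Qubit)) : Set ℝ :=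
  {t | ∃ Λ ∈ LOCC Qubit Qubit, t = overlap (Λ ρ)}

/-- The maximal overlap `f(ρ)` with the Bell state under LOCC. -/
def maxOverlap (ρ : Op (Qubit × Qubit)) : ℝ :=
  sSup (overlapValues ρ)

/-- The partial trace over the first factor. -/
def traceFst {s c : Type} [Fintype s] (M : Op (s × c)) : Op c :=
  Matrix.of fun i j => ∑ k, M (k, i) (k, j)

/-- The state `φ_A ⊗ ρ_BC`, as an operator on `(A ⊗ B) ⊗ C`. -/
def inputState (φ : Op Qubit) (ρ : Op (Qubit × Qubit)) : Op ((Qubit × Qubit) × Qubit) :=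
  Matrix.reindex (Equiv.prodAssoc Qubit Qubit Qubit).symm
    (Equiv.prodAssoc Qubit Qubit Qubit).symm (φ ⊗ₖ ρ)

/-- `V`, acting on the qubits `A, B, C`, mimics with the resource `ρ_BC` the identity from `A` to
`C`: `Tr_AB[V(φ ⊗ ρ_BC)] = φ` for all density operators `φ` on `A`. -/
def IsWire (ρ : Op (Qubit × Qubit))
    (V : SuperOp ((Qubit × Qubit) × Qubit) ((Qubit × Qubit) × Qubit)) : Prop :=
  ∀ φ : Op Qubit, IsDensity φ → traceFst (V (inputState φ ρ)) = φ

/-- The sampling overheads `∑ |c i|` of the quasiprobability decompositions `V = ∑ c i • F i`,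
with `F i` in `LOCC(A ⊗ B, C)`, of the operators `V` that cut a wire with the resource `ρ`. -/
def cutOverheads (ρ : Op (Qubit × Qubit)) : Set ℝ :=
  {κ | ∃ (m : ℕ) (c : Fin m → ℝ)
      (F : Fin m → SuperOp ((Qubit × Qubit) × Qubit) ((Qubit × Qubit) × Qubit))
      (V : SuperOp ((Qubit × Qubit) × Qubit) ((Qubit × Qubit) × Qubit)),
      (∀ i, F i ∈ LOCC (Qubit × Qubit) Qubit) ∧ V = ∑ i, (c i : ℂ) • F i ∧
      IsWire ρ V ∧ κ = ∑ i, |c i|}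

/-- The optimal sampling overhead of a single-qubit wire cut with the resource `ρ`. -/
def optimalCutOverhead (ρ : Op (Qubit × Qubit)) : ℝ :=
  sInf (cutOverheads ρ)

end WireCut

end

noncomputable section

namespace WireCut

/-! Both halves rest on one inequality: if a rejected branch is credited with overlap 1/2, which a
product state delivers anyway, then no LOCC map beats f, that is, overlap + (1 - trace)/2 ≤ f
(`exists_isGreatest_overlapValues`).

The inequality comes from the partial transpose Γ. LOCC maps preserve positivity of Γσ, and Γ sends
the singlet projector to 1/2 - |Φ⟩⟨Φ|. Hence trace/2 - overlap of the output, read as a functional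
of Γσ, is Tr(X Γσ) with X ≥ 0. A positive two-qubit X is a single ψψ† plus projections onto product
vectors, and the latter stay positive under Γ, so the overlap is at most Tr σ/2 - ⟨ψ|Γσ|ψ⟩
(`exists_filterVector_bound`). The admissible ψ form a compact set, and each is realized by
filtering one qubit and preparing |00⟩ on failure (`exists_locc_of_mem_filterVectors`). This gives
the maximum.

Lower bound on the overhead (`le_of_mem_cutOverheads`): feeding half of a Bell pair into A turns
each term into an LOCC map on B ⊗ C whose output on ρ is a normalized Choi operator. With the
coefficients c these outputs sum to |Φ⟩⟨Φ|. The functional (2/f)·overlap - trace equals 2/f - 1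
there and lies in [-1, 1] on every LOCC output, so it is a dual witness.

Upper bound (`mem_cutOverheads`): with a resource of trace 1 and overlap f, twirled teleportation is
f·id + (1 - f)·N, where N φ = (2 Tr φ · 1 - φ)/3 is the universal NOT. N itself needs only local
measurement and preparation, and id = (1/f)·T - (1/f - 1)·N costs 2/f - 1. -/

@[simp]
theorem conjBy_apply {a x : Type} [Fintype a] (K : Matrix x a ℂ) (M : Op a) :
    conjBy K M = K * M * Kᴴ := rfl

/-- Over `ℂ`, a matrix with nonnegative quadratic form is automatically Hermitian. -/
theorem posSemidef_of_forall_nonneg {n : Type} [Fintype n] {M : Op n}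
    (h : ∀ x : n → ℂ, 0 ≤ star x ⬝ᵥ (M *ᵥ x)) : M.PosSemidef := by
  classical
  refine .of_dotProduct_mulVec_nonneg ?_ h
  rw [← Matrix.isSymmetric_toEuclideanLin_iff, LinearMap.isSymmetric_iff_inner_map_self_real]
  intro v
  have hv := h v.ofLp
  rw [Complex.conj_eq_iff_im]
  have e : inner ℂ (Matrix.toEuclideanLin M v) v = star (star v.ofLp ⬝ᵥ (M *ᵥ v.ofLp)) := by
    rw [← inner_conj_symm, EuclideanSpace.inner_eq_star_dotProduct, dotProduct_comm]
    rfl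
  rw [e, Complex.star_def, Complex.conj_im, (Complex.nonneg_iff.1 hv).2.symm, neg_zero]

/-! ### Partial transposition and local Kraus operators -/

/-- The partial transpose over the second factor. -/
def partialTranspose {a b : Type} : SuperOp (a × b) (a × b) where
  toFun M := Matrix.of fun p q => M (p.1, q.2) (q.1, p.2)
  map_add' _ _ := rfl
  map_smul' _ _ := rfl

theorem partialTranspose_apply {a b : Type} (M : Op (a × b)) (p q : a × b) :
    partialTranspose M p q = M (p.1, q.2) (q.1, p.2) := rfl

@[simp]
theorem partialTranspose_partialTranspose {a b : Type} (M : Op (a × b)) :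
    partialTranspose (partialTranspose M) = M := rfl

section

variable {a b x : Type} [Fintype a] [Fintype b]

theorem conjBy_kronecker_one_apply [DecidableEq b] (K : Matrix x a ℂ) (M : Op (a × b)) (p q : x × b) :
    conjBy (K ⊗ₖ (1 : Matrix b b ℂ)) M p q =
      ∑ i, ∑ j, K p.1 i * M (i, p.2) (j, q.2) * star (K q.1 j) := by
  simp only [conjBy_apply, Matrix.mul_apply, Fintype.sum_prod_type, Matrix.kroneckerMap_apply,
    Matrix.one_apply, Matrix.conjTranspose_apply, Finset.sum_mul]
  simp only [mul_ite, mul_one, mul_zero, ite_mul, zero_mul, Finset.sum_ite_eq, Finset.mem_univ,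
    if_true, apply_ite star, star_zero, Finset.sum_ite_irrel, Finset.sum_const_zero]
  rw [Finset.sum_comm]

theorem conjBy_one_kronecker_apply [DecidableEq a] (K : Matrix x b ℂ) (M : Op (a × b)) (p q : a × x) :
    conjBy ((1 : Matrix a a ℂ) ⊗ₖ K) M p q =
      ∑ i, ∑ j, K p.2 i * M (p.1, i) (q.1, j) * star (K q.2 j) := by
  simp [Matrix.mul_apply, Fintype.sum_prod_type, Matrix.one_apply, Finset.sum_mul,
    Finset.sum_ite_irrel, apply_ite]
  rw [Finset.sum_comm]

theorem partialTranspose_conjBy_kronecker_one [DecidableEq b] (K : Matrix x a ℂ) (M : Op (a × b)) :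
    partialTranspose (conjBy (K ⊗ₖ (1 : Matrix b b ℂ)) M) =
      conjBy (K ⊗ₖ (1 : Matrix b b ℂ)) (partialTranspose M) := by
  ext p q
  simp only [partialTranspose_apply, conjBy_kronecker_one_apply]

theorem partialTranspose_conjBy_one_kronecker [DecidableEq a] (K : Matrix x b ℂ) (M : Op (a × b)) :
    partialTranspose (conjBy ((1 : Matrix a a ℂ) ⊗ₖ K) M) =
      conjBy ((1 : Matrix a a ℂ) ⊗ₖ K.map star) (partialTranspose M) := by
  ext p q
  simp only [partialTranspose_apply, conjBy_one_kronecker_apply]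
  rw [Finset.sum_comm]
  refine Finset.sum_congr rfl fun i _ => Finset.sum_congr rfl fun j _ => ?_
  simp; ring

end

theorem posSemidef_conjBy {a x : Type} [Fintype a] [Finite x] (K : Matrix x a ℂ) {M : Op a}
    (hM : M.PosSemidef) : (conjBy K M).PosSemidef :=
  hM.mul_mul_conjTranspose_same K

theorem trace_sum_conjBy {ι a x : Type} [Fintype ι] [Fintype a] [DecidableEq a] [Fintype x]
    (K : ι → Matrix x a ℂ) (hK : ∑ i, (K i)ᴴ * K i = 1) (M : Op a) :
    ∑ i, (conjBy (K i) M).trace = M.trace := by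
  calc ∑ i, (conjBy (K i) M).trace = ∑ i, ((K i)ᴴ * K i * M).trace :=
        Finset.sum_congr rfl fun i _ => by
          rw [conjBy_apply, Matrix.trace_mul_comm, Matrix.mul_assoc]
    _ = M.trace := by rw [← Matrix.trace_sum, ← Finset.sum_mul, hK, one_mul]

section

variable {ι a b x : Type} [Fintype ι] [DecidableEq a] [DecidableEq b] [Fintype x]

theorem sum_kraus_kronecker_one [Fintype b] {K : ι → Matrix x a ℂ} (hK : ∑ i, (K i)ᴴ * K i = 1) :
    ∑ i, (K i ⊗ₖ (1 : Matrix b b ℂ))ᴴ * (K i ⊗ₖ (1 : Matrix b b ℂ)) = 1 := by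
  simp only [Matrix.conjTranspose_kronecker, ← Matrix.mul_kronecker_mul]
  simp only [Matrix.conjTranspose_one, mul_one]
  rw [← Matrix.one_kronecker_one, ← hK]
  ext p q
  simp [Matrix.sum_apply, Finset.sum_mul]

theorem sum_kraus_one_kronecker [Fintype a] {K : ι → Matrix x b ℂ} (hK : ∑ i, (K i)ᴴ * K i = 1) :
    ∑ i, ((1 : Matrix a a ℂ) ⊗ₖ K i)ᴴ * ((1 : Matrix a a ℂ) ⊗ₖ K i) = 1 := by
  simp only [Matrix.conjTranspose_kronecker, ← Matrix.mul_kronecker_mul]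
  simp only [Matrix.conjTranspose_one, mul_one]
  rw [← Matrix.one_kronecker_one, ← hK]
  ext p q
  simp [Matrix.sum_apply, Finset.mul_sum]

end

/-! ### Invariants and closure properties of LOCC maps -/

section

variable {a' b' a b : Type} [Fintype a] [DecidableEq a] [Fintype b] [DecidableEq b]
  {Λ : SuperOp (a × b) (a' × b')}

theorem IsLOCC.posSemidef [Fintype a'] [Fintype b'] (h : IsLOCC a' b' a b Λ)
    {σ : Op (a × b)} (hσ : σ.PosSemidef) :
    (Λ σ).PosSemidef ∧ (Λ σ).trace ≤ σ.trace := by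
  induction h with
  | done => exact ⟨hσ, le_of_eq (by simp only [LinearMap.id_apply]; congr!)⟩
  | fail => exact ⟨.zero, by simpa using hσ.trace_nonneg⟩
  | left a b x m K hK Λ hΛ ih =>
    simp only [LinearMap.sum_apply, LinearMap.comp_apply]
    have := fun i => ih i (posSemidef_conjBy (K i ⊗ₖ (1 : Matrix b b ℂ)) hσ)
    refine ⟨Matrix.posSemidef_sum _ fun i _ => (this i).1, ?_⟩
    rw [Matrix.trace_sum, ← trace_sum_conjBy _ (sum_kraus_kronecker_one hK)]
    exact Finset.sum_le_sum fun i _ => (this i).2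
  | right a b x m K hK Λ hΛ ih =>
    simp only [LinearMap.sum_apply, LinearMap.comp_apply]
    have := fun i => ih i (posSemidef_conjBy ((1 : Matrix a a ℂ) ⊗ₖ K i) hσ)
    refine ⟨Matrix.posSemidef_sum _ fun i _ => (this i).1, ?_⟩
    rw [Matrix.trace_sum, ← trace_sum_conjBy _ (sum_kraus_one_kronecker hK)]
    exact Finset.sum_le_sum fun i _ => (this i).2

/-- Partial transposition turns a local Kraus operator into a local Kraus operator, complex
conjugated on the second side, so positivity survives every round. -/
theorem IsLOCC.partialTranspose_posSemidef (h : IsLOCC a' b' a b Λ) {σ : Op (a × b)}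
    (hσ : (partialTranspose σ).PosSemidef) : (partialTranspose (Λ σ)).PosSemidef := by
  induction h with
  | done => exact hσ
  | fail => simpa using .zero
  | left a b x m K hK Λ hΛ ih =>
    simp only [LinearMap.sum_apply, LinearMap.comp_apply, map_sum]
    refine Matrix.posSemidef_sum _ fun i _ => ih i ?_
    rw [partialTranspose_conjBy_kronecker_one]
    exact posSemidef_conjBy _ hσ
  | right a b x m K hK Λ hΛ ih =>
    simp only [LinearMap.sum_apply, LinearMap.comp_apply, map_sum]
    refine Matrix.posSemidef_sum _ fun i _ => ih i ?_
    rw [partialTranspose_conjBy_one_kronecker]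
    exact posSemidef_conjBy _ hσ

end

section

variable {a' b' a b : Type} [Fintype a] [DecidableEq a] [Fintype b] [DecidableEq b]

/-- The second protocol is grafted onto every accepted leaf of the first; rejected leaves stay
rejected. -/
theorem IsLOCC.comp [Fintype a'] [DecidableEq a'] [Fintype b'] [DecidableEq b'] {a'' b'' : Type}
    {Λ : SuperOp (a × b) (a' × b')} {Λ' : SuperOp (a' × b') (a'' × b'')}
    (h' : IsLOCC a'' b'' a' b' Λ') (h : IsLOCC a' b' a b Λ) :
    IsLOCC a'' b'' a b (Λ' ∘ₗ Λ) := by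
  induction h with
  | done =>
    rw [LinearMap.comp_id]
    convert h'
  | fail =>
    rw [LinearMap.comp_zero]
    exact .fail _ _
  | left a b x m K hK Λ hΛ ih =>
    have := IsLOCC.left a b x m K hK (fun i => Λ' ∘ₗ Λ i) fun i => ih i
    convert this using 1
    ext1 M
    simp
  | right a b x m K hK Λ hΛ ih =>
    have := IsLOCC.right a b x m K hK (fun i => Λ' ∘ₗ Λ i) fun i => ih i
    convert this using 1
    ext1 M
    simp

/-- The local measurement of the first party with outcomes in any finite type. -/
theorem IsLOCC.left_fintype {ι x : Type} [Fintype ι] [Fintype x] [DecidableEq x]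
    {K : ι → Matrix x a ℂ} (hK : ∑ i, (K i)ᴴ * K i = 1) {Λ : ι → SuperOp (x × b) (a' × b')}
    (hΛ : ∀ i, IsLOCC a' b' x b (Λ i)) :
    IsLOCC a' b' a b (∑ i, Λ i ∘ₗ conjBy (K i ⊗ₖ (1 : Matrix b b ℂ))) := by
  let e := (Fintype.equivFin ι).symm
  have := IsLOCC.left (a' := a') (b' := b') a b x _ (K ∘ e)
    (by rw [← hK]; exact e.sum_comp fun i => (K i)ᴴ * K i) (Λ ∘ e) fun i => hΛ _
  rwa [← e.sum_comp fun i => Λ i ∘ₗ conjBy (K i ⊗ₖ (1 : Matrix b b ℂ))]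

/-- The local measurement of the second party with outcomes in any finite type. -/
theorem IsLOCC.right_fintype {ι x : Type} [Fintype ι] [Fintype x] [DecidableEq x]
    {K : ι → Matrix x b ℂ} (hK : ∑ i, (K i)ᴴ * K i = 1) {Λ : ι → SuperOp (a × x) (a' × b')}
    (hΛ : ∀ i, IsLOCC a' b' a x (Λ i)) :
    IsLOCC a' b' a b (∑ i, Λ i ∘ₗ conjBy ((1 : Matrix a a ℂ) ⊗ₖ K i)) := by
  let e := (Fintype.equivFin ι).symm
  have := IsLOCC.right (a' := a') (b' := b') a b x _ (K ∘ e)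
    (by rw [← hK]; exact e.sum_comp fun i => (K i)ᴴ * K i) (Λ ∘ e) fun i => hΛ _
  rwa [← e.sum_comp fun i => Λ i ∘ₗ conjBy ((1 : Matrix a a ℂ) ⊗ₖ K i)]

end

/-- The superoperator `id ⊗ Λ`, the first party holding the spectator system `s`. -/
def withSpectator (s : Type) {a b a' b' : Type} (Λ : SuperOp (a × b) (a' × b')) :
    SuperOp ((s × a) × b) ((s × a') × b') where
  toFun M := Matrix.of fun p q =>
    Λ (Matrix.of fun x y => M ((p.1.1, x.1), x.2) ((q.1.1, y.1), y.2)) (p.1.2, p.2) (q.1.2, q.2)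
  map_add' M N := by
    ext p q
    exact congrFun (congrFun (Λ.map_add
      (Matrix.of fun x y => M ((p.1.1, x.1), x.2) ((q.1.1, y.1), y.2))
      (Matrix.of fun x y => N ((p.1.1, x.1), x.2) ((q.1.1, y.1), y.2))) _) _
  map_smul' c M := by
    ext p q
    exact congrFun (congrFun (Λ.map_smul c
      (Matrix.of fun x y => M ((p.1.1, x.1), x.2) ((q.1.1, y.1), y.2))) _) _

theorem withSpectator_apply (s : Type) {a b a' b' : Type} (Λ : SuperOp (a × b) (a' × b'))
    (M : Op ((s × a) × b)) (p q : (s × a') × b') :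
    withSpectator s Λ M p q =
      Λ (Matrix.of fun x y => M ((p.1.1, x.1), x.2) ((q.1.1, y.1), y.2)) (p.1.2, p.2)
        (q.1.2, q.2) := rfl

theorem IsLOCC.withSpectator {a' b' a b : Type} [Fintype a] [DecidableEq a] [Fintype b]
    [DecidableEq b] {Λ : SuperOp (a × b) (a' × b')} (h : IsLOCC a' b' a b Λ) (s : Type)
    [Fintype s] [DecidableEq s] :
    IsLOCC (s × a') b' (s × a) b (WireCut.withSpectator s Λ) := by
  induction h with
  | done => exact .done
  | fail => exact .fail _ _
  | left a b x m K hK Λ hΛ ih =>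
    have := IsLOCC.left (s × a) b (s × x) m (fun i => (1 : Matrix s s ℂ) ⊗ₖ K i)
      (sum_kraus_one_kronecker hK) _ ih
    convert this using 1
    ext1 M
    ext p q
    simp only [withSpectator_apply, LinearMap.sum_apply, LinearMap.comp_apply, Matrix.sum_apply]
    refine Finset.sum_congr rfl fun i _ => ?_
    refine congrFun (congrFun (congrArg (Λ i) ?_) _) _
    ext y z
    simp [conjBy_kronecker_one_apply, Fintype.sum_prod_type, Matrix.one_apply, apply_ite,
      Finset.sum_ite_irrel]
  | right a b x m K hK Λ hΛ ih =>
    have := IsLOCC.right (s × a) b x m K hK _ ih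
    convert this using 1
    ext1 M
    ext p q
    simp only [withSpectator_apply, LinearMap.sum_apply, LinearMap.comp_apply, Matrix.sum_apply]
    refine Finset.sum_congr rfl fun i _ => ?_
    refine congrFun (congrFun (congrArg (Λ i) ?_) _) _
    ext y z
    simp [conjBy_one_kronecker_apply]

/-! ### Expectations and trace functionals -/

/-- The expectation `⟨x|M|x⟩`, linear in `M`. -/
def expect {n : Type} [Fintype n] (x : n → ℂ) : Op n →ₗ[ℂ] ℂ where
  toFun M := star x ⬝ᵥ (M *ᵥ x)
  map_add' M N := by rw [Matrix.add_mulVec, dotProduct_add]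
  map_smul' c M := by rw [Matrix.smul_mulVec, dotProduct_smul, RingHom.id_apply]

theorem expect_apply {n : Type} [Fintype n] (x : n → ℂ) (M : Op n) :
    expect x M = star x ⬝ᵥ (M *ᵥ x) := rfl

theorem expect_eq_sum {n : Type} [Fintype n] (x : n → ℂ) (M : Op n) :
    expect x M = ∑ i, ∑ j, star (x i) * M i j * x j := by
  simp [expect_apply, dotProduct, Matrix.mulVec, Finset.mul_sum, mul_assoc]

theorem expect_nonneg {n : Type} [Fintype n] (x : n → ℂ) {M : Op n} (hM : M.PosSemidef) :
    0 ≤ expect x M :=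
  hM.dotProduct_mulVec_nonneg x

theorem expect_conjBy {a x : Type} [Fintype a] [Fintype x] (v : x → ℂ) (K : Matrix x a ℂ)
    (M : Op a) : expect v (conjBy K M) = expect (Kᴴ *ᵥ v) M := by
  simp only [expect_apply, conjBy_apply, Matrix.star_mulVec, Matrix.conjTranspose_conjTranspose,
    ← Matrix.mulVec_mulVec, ← Matrix.dotProduct_mulVec]

theorem trace_mul_vecMulVec {n : Type} [Fintype n] (M : Op n) (x : n → ℂ) :
    (M * Matrix.vecMulVec x (star x)).trace = expect x M := by
  rw [Matrix.mul_vecMulVec, Matrix.trace_vecMulVec, dotProduct_comm]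
  rfl

theorem trace_mul_nonneg {n : Type} [Fintype n] {M N : Op n} (hM : M.PosSemidef)
    (hN : N.PosSemidef) : 0 ≤ (M * N).trace := by
  obtain ⟨m, v, rfl⟩ := Matrix.posSemidef_iff_eq_sum_vecMulVec.1 hN
  rw [Finset.mul_sum, Matrix.trace_sum]
  exact Finset.sum_nonneg fun i _ => by
    rw [trace_mul_vecMulVec]
    exact expect_nonneg _ hM

theorem trace_partialTranspose_mul {a b : Type} [Fintype a] [Fintype b] (M N : Op (a × b)) :
    (partialTranspose M * N).trace = (M * partialTranspose N).trace := by
  simp only [Matrix.trace, Matrix.diag, Matrix.mul_apply, partialTranspose_apply,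
    Fintype.sum_prod_type]
  refine Finset.sum_congr rfl fun i _ => ?_
  rw [Finset.sum_comm, Finset.sum_comm (γ := b)]
  refine (Finset.sum_congr rfl fun j _ => ?_)
  rw [Finset.sum_comm]

/-- Every linear functional on operators is of the form `τ ↦ Tr (X τ)`. -/
theorem exists_eq_trace_mul {n : Type} [Fintype n] [DecidableEq n] (L : Op n →ₗ[ℂ] ℂ) :
    ∃ X : Op n, ∀ τ, L τ = (X * τ).trace := by
  refine ⟨Matrix.of fun i j => L (Matrix.single j i 1), fun τ => ?_⟩
  conv_lhs => rw [Matrix.matrix_eq_sum_single τ]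
  simp only [map_sum, Matrix.trace, Matrix.diag, Matrix.mul_apply, Matrix.of_apply]
  rw [Finset.sum_comm]
  refine Finset.sum_congr rfl fun i _ => Finset.sum_congr rfl fun j _ => ?_
  rw [show Matrix.single j i (τ j i) = τ j i • Matrix.single j i (1 : ℂ) by simp, map_smul,
    smul_eq_mul, mul_comm]

/-! ### Splitting product projections off a positive two-qubit operator -/

/-- The determinant of the coefficient matrix of a two-qubit vector. It vanishes precisely on the
product vectors. -/
def vecDet (v : Qubit × Qubit → ℂ) : ℂ := v (0, 0) * v (1, 1) - v (0, 1) * v (1, 0)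

theorem exists_product_of_vecDet_eq_zero {v : Qubit × Qubit → ℂ} (h : vecDet v = 0) :
    ∃ x y : Qubit → ℂ, ∀ p, v p = x p.1 * y p.2 := by
  unfold vecDet at h
  by_cases h0 : v (0, 0) = 0
  · by_cases h1 : v (0, 1) = 0
    · refine ⟨![0, 1], ![v (1, 0), v (1, 1)], ?_⟩
      rintro ⟨i, j⟩
      fin_cases i <;> fin_cases j <;> simp [h0, h1]
    · have h2 : v (1, 0) = 0 := by simpa [h0, h1] using h
      refine ⟨![v (0, 1), v (1, 1)], ![0, 1], ?_⟩
      rintro ⟨i, j⟩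
      fin_cases i <;> fin_cases j <;> simp [h0, h2]
  · refine ⟨![v (0, 0), v (1, 0)], ![1, v (0, 1) / v (0, 0)], ?_⟩
    rintro ⟨i, j⟩
    fin_cases i <;> fin_cases j <;> simp <;> field_simp
    linear_combination h

/-- On the projection onto x ⊗ y, partial transposition only replaces y by its complex conjugate. -/
theorem posSemidef_partialTranspose_of_vecDet_eq_zero {v : Qubit × Qubit → ℂ}
    (h : vecDet v = 0) : (partialTranspose (Matrix.vecMulVec v (star v))).PosSemidef := by
  obtain ⟨x, y, hxy⟩ := exists_product_of_vecDet_eq_zero h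
  convert Matrix.posSemidef_vecMulVec_self_star fun p : Qubit × Qubit => x p.1 * star (y p.2)
  ext p q
  simp only [partialTranspose_apply, Matrix.vecMulVec_apply, hxy, Pi.star_apply, star_mul',
    star_star]
  ring

/-- Two two-qubit vectors can be rotated unitarily into each other such that the first one becomes
a product vector. -/
theorem exists_rotation_vecDet_eq_zero (v w : Qubit × Qubit → ℂ) :
    ∃ α β : ℂ, star α * α + star β * β = 1 ∧ vecDet (α • v + β • w) = 0 := by
  by_cases hv : vecDet v = 0
  · exact ⟨1, 0, by simp, by simpa using hv⟩
  -- The determinant of t v + w is a quadratic polynomial in t with leading coefficient `vecDet v` ≠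
  -- 0 and middle coefficient b; it has a complex root, and r normalizes the pair (t, 1).
  let b := v (0, 0) * w (1, 1) + w (0, 0) * v (1, 1) - v (0, 1) * w (1, 0) - w (0, 1) * v (1, 0)
  obtain ⟨t, ht⟩ := exists_quadratic_eq_zero (b := b) (c := vecDet w) hv
    (IsAlgClosed.exists_eq_mul_self _)
  have hpos : 0 < ‖t‖ ^ 2 + 1 := by positivity
  let r : ℝ := (Real.sqrt (‖t‖ ^ 2 + 1))⁻¹
  have hr : r ^ 2 * (‖t‖ ^ 2 + 1) = 1 := by
    simp only [r]
    rw [inv_pow, Real.sq_sqrt hpos.le, inv_mul_cancel₀ hpos.ne']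
  refine ⟨r * t, r, ?_, ?_⟩
  · have h1 : star t * t = ((‖t‖ ^ 2 : ℝ) : ℂ) := by
      rw [Complex.star_def, Complex.conj_mul', Complex.ofReal_pow]
    have h2 : ((r ^ 2 * (‖t‖ ^ 2 + 1) : ℝ) : ℂ) = 1 := by rw [hr, Complex.ofReal_one]
    push_cast at h1 h2
    simp only [star_mul', Complex.star_def, Complex.conj_ofReal] at h1 ⊢
    linear_combination (r : ℂ) ^ 2 * h1 + h2
  · simp only [vecDet, b] at ht
    simp only [vecDet, Pi.add_apply, Pi.smul_apply, smul_eq_mul]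
    linear_combination (r : ℂ) ^ 2 * ht

/-- A two-qubit positive operator is, up to a rank-one positive operator, a sum of projections
onto product vectors; the remainder has positive partial transpose. -/
theorem exists_sub_partialTranspose_posSemidef {X : Op (Qubit × Qubit)} (hX : X.PosSemidef) :
    ∃ ψ, (partialTranspose (X - Matrix.vecMulVec ψ (star ψ))).PosSemidef := by
  obtain ⟨m, w, rfl⟩ := Matrix.posSemidef_iff_eq_sum_vecMulVec.1 hX
  clear hX
  rcases m with _ | m
  · exact ⟨0, by simpa using .zero⟩
  induction m with
  | zero => exact ⟨w 0, by simpa using .zero⟩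
  | succ m ih =>
    -- A unitary rotation of two vectors leaves the sum of their projections unchanged. One rotated
    -- vector is a product and is split off; the other takes the place of the pair, so the number of
    -- vectors drops by one.
    obtain ⟨α, β, h1, h2⟩ := exists_rotation_vecDet_eq_zero (w 0) (w 1)
    obtain ⟨ψ, hψ⟩ := ih (Fin.cons (-star β • w 0 + star α • w 1) fun i => w i.succ.succ)
    refine ⟨ψ, ?_⟩
    convert hψ.add (posSemidef_partialTranspose_of_vecDet_eq_zero h2) using 1
    rw [← map_add]
    congr 1
    simp only [Fin.sum_univ_succ, Fin.cons_zero, Fin.cons_succ, Fin.succ_zero_eq_one]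
    have : Matrix.vecMulVec (w 0) (star (w 0)) + Matrix.vecMulVec (w 1) (star (w 1)) =
        Matrix.vecMulVec (-star β • w 0 + star α • w 1) (star (-star β • w 0 + star α • w 1)) +
        Matrix.vecMulVec (α • w 0 + β • w 1) (star (α • w 0 + β • w 1)) := by
      ext p q
      simp only [Matrix.add_apply, Matrix.vecMulVec_apply, Pi.add_apply, Pi.smul_apply,
        Pi.star_apply, smul_eq_mul, star_add, star_mul', star_star, star_neg]
      linear_combination -(w 0 p * star (w 0 q) + w 1 p * star (w 1 q)) * h1
    rw [← add_assoc, this]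
    abel

/-! ### Bounding the Bell overlap by filter vectors -/

/-- The singlet vector `(|01⟩ - |10⟩) / √2`. -/
def singlet : Qubit × Qubit → ℂ :=
  fun p => ((1 / Real.sqrt 2 : ℝ) : ℂ) * !![0, 1; -1, 0] p.1 p.2

theorem ofReal_inv_sqrt_two_mul_self :
    ((1 / Real.sqrt 2 : ℝ) : ℂ) * ((1 / Real.sqrt 2 : ℝ) : ℂ) = 1 / 2 := by
  rw [← Complex.ofReal_mul, div_mul_div_comm, Real.mul_self_sqrt zero_le_two]
  norm_num

/-- The singlet projector is (1 - SWAP)/2, and the partial transpose of SWAP is 2|Φ⟩⟨Φ|. -/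
theorem expect_singlet_partialTranspose (τ : Op (Qubit × Qubit)) :
    expect singlet (partialTranspose τ) = τ.trace / 2 - expect bell τ := by
  have h := ofReal_inv_sqrt_two_mul_self
  simp only [expect_eq_sum, Fintype.sum_prod_type, Fin.sum_univ_two, singlet, bell,
    partialTranspose_apply, Matrix.trace, Matrix.diag]
  generalize (1 / Real.sqrt 2 : ℝ) = s at h ⊢
  simp
  linear_combination (τ (0, 0) (0, 0) + τ (1, 1) (1, 1) + τ (0, 1) (0, 1) + τ (1, 0) (1, 0)) * h

/-- The vectors `ψ` for which `1/2 - ψψ†^Γ` is a positive functional: up to normalization, those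
with a contractive coefficient matrix. -/
def filterVectors : Set (Qubit × Qubit → ℂ) :=
  {ψ | ∀ σ : Op (Qubit × Qubit), σ.PosSemidef → expect ψ (partialTranspose σ) ≤ σ.trace / 2}

/-- The overlap with the Bell vector after an LOCC map, rejected branches counting `1/2`, is
bounded by that of a local filter. -/
theorem exists_filterVector_bound {Λ : SuperOp (Qubit × Qubit) (Qubit × Qubit)}
    (h : IsLOCC Qubit Qubit Qubit Qubit Λ) :
    ∃ ψ ∈ filterVectors, ∀ σ : Op (Qubit × Qubit), σ.PosSemidef →
      expect bell (Λ σ) + (σ.trace - (Λ σ).trace) / 2 ≤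
        σ.trace / 2 - expect ψ (partialTranspose σ) := by
  let L : Op (Qubit × Qubit) →ₗ[ℂ] ℂ :=
    ((1 / 2 : ℂ) • Matrix.traceLinearMap _ ℂ ℂ - expect bell) ∘ₗ Λ ∘ₗ partialTranspose
  have hL : ∀ τ, L τ = expect singlet (partialTranspose (Λ (partialTranspose τ))) := fun τ => by
    rw [expect_singlet_partialTranspose]
    simp [L]
    ring
  obtain ⟨X, hX⟩ := exists_eq_trace_mul L
  -- The operator fed into Λ is the partial transpose of xx†, so it has positive partial transpose
  -- although it need not be positive; this is the property that Λ preserves.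
  have hXpos : X.PosSemidef := posSemidef_of_forall_nonneg fun x => by
    rw [← expect_apply, ← trace_mul_vecMulVec, ← hX, hL]
    exact expect_nonneg _ (h.partialTranspose_posSemidef (by
      simpa using Matrix.posSemidef_vecMulVec_self_star x))
  obtain ⟨ψ, hψ⟩ := exists_sub_partialTranspose_posSemidef hXpos
  have key : ∀ σ : Op (Qubit × Qubit), σ.PosSemidef →
      expect bell (Λ σ) + (σ.trace - (Λ σ).trace) / 2 ≤
        σ.trace / 2 - expect ψ (partialTranspose σ) := fun σ hσ => by
    have h1 := trace_mul_nonneg hψ hσ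
    rw [trace_partialTranspose_mul, sub_mul, Matrix.trace_sub, ← hX, hL,
      partialTranspose_partialTranspose, expect_singlet_partialTranspose,
      Matrix.trace_mul_comm, trace_mul_vecMulVec] at h1
    rw [← sub_nonneg]
    convert h1 using 1
    ring
  -- The left side of `key` is nonnegative because Λ is positive and trace-nonincreasing; that is
  -- exactly membership in `filterVectors`.
  refine ⟨ψ, fun σ hσ => ?_, key⟩
  have h2 := (h.posSemidef hσ).2
  have h3 := expect_nonneg bell (h.posSemidef hσ).1
  rw [← sub_nonneg]
  refine le_trans ?_ (key σ hσ)
  exact add_nonneg h3 (div_nonneg (sub_nonneg.2 h2) zero_le_two)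

theorem expect_zero_left {n : Type} [Fintype n] (M : Op n) : expect 0 M = 0 := by
  simp [expect_apply]

theorem continuous_expect {n : Type} [Fintype n] (M : Op n) :
    Continuous fun x : n → ℂ => expect x M := by
  simp only [expect_eq_sum]
  fun_prop

/-- The conditions are closed in ψ, and testing on the projection onto a basis vector p gives |ψ p|²
≤ 1/2. -/
theorem isCompact_filterVectors : IsCompact filterVectors := by
  refine (isCompact_univ_pi fun _ => isCompact_closedBall (0 : ℂ) 1).of_isClosed_subset
    ?_ fun ψ hψ => ?_
  · simp only [filterVectors, Set.ofPred_forall]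
    exact isClosed_iInter fun σ => isClosed_iInter fun _ =>
      isClosed_le (continuous_expect _) continuous_const
  · simp only [Set.mem_univ_pi, mem_closedBall_zero_iff]
    intro p
    have h := hψ _ (Matrix.posSemidef_vecMulVec_self_star (Pi.single p (1 : ℂ)))
    have h1 : expect ψ (partialTranspose (Matrix.vecMulVec (Pi.single p (1 : ℂ))
        (star (Pi.single p 1)))) = ((‖ψ p‖ ^ 2 : ℝ) : ℂ) := by
      rw [expect_eq_sum, Finset.sum_eq_single p, Finset.sum_eq_single p]
      · simp [partialTranspose_apply, Matrix.vecMulVec_apply, Complex.conj_mul']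
      · rintro q - hq
        simp only [partialTranspose_apply, Matrix.vecMulVec_apply, Pi.single_apply, Pi.star_apply]
        split_ifs with h1 h2 <;> simp
        exact absurd (Prod.ext (by simpa using congrArg Prod.fst h2)
          (by simpa using congrArg Prod.snd h1)) hq
      · simp
      · rintro q - hq
        refine Finset.sum_eq_zero fun r _ => ?_
        simp only [partialTranspose_apply, Matrix.vecMulVec_apply, Pi.single_apply, Pi.star_apply]
        split_ifs with h1 h2 <;> simp
        exact absurd (Prod.ext (by simpa using congrArg Prod.fst h1)
          (by simpa using congrArg Prod.snd h2)) hq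
      · simp
    have h2 : (Matrix.vecMulVec (Pi.single p (1 : ℂ)) (star (Pi.single p 1))).trace = 1 := by
      rw [Matrix.trace_vecMulVec]
      simp
    rw [h1, h2, show (1 / 2 : ℂ) = ((1 / 2 : ℝ) : ℂ) by push_cast; rfl, Complex.real_le_real] at h
    nlinarith [norm_nonneg (ψ p)]

theorem zero_mem_filterVectors : 0 ∈ filterVectors := fun σ hσ => by
  rw [expect_zero_left]
  exact div_nonneg hσ.trace_nonneg zero_le_two

/-! ### Protocols realizing the filter vectors -/

theorem sum_single_kraus {a x : Type} [Fintype a] [DecidableEq a] [Fintype x] [DecidableEq x]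
    (t : x) : ∑ k : a, (Matrix.single t k (1 : ℂ))ᴴ * Matrix.single t k (1 : ℂ) = 1 := by
  simp only [Matrix.conjTranspose_single, Matrix.single_mul_single_same, star_one, mul_one]
  ext i j
  simp only [Matrix.sum_apply, Matrix.single_apply, Matrix.one_apply, ite_and, Finset.sum_ite_eq',
    Finset.mem_univ, if_true]

/-- Both qubits are discarded and prepared in the state `|0⟩`. -/
def reset : SuperOp (Qubit × Qubit) (Qubit × Qubit) :=
  ∑ k : Qubit, (∑ l : Qubit, LinearMap.id ∘ₗ conjBy ((1 : Op Qubit) ⊗ₖ Matrix.single 0 l 1)) ∘ₗ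
    conjBy (Matrix.single 0 k 1 ⊗ₖ (1 : Op Qubit))

theorem isLOCC_reset : IsLOCC Qubit Qubit Qubit Qubit reset :=
  .left_fintype (sum_single_kraus 0) fun _ => .right_fintype (sum_single_kraus 0) fun _ => .done

theorem expect_bell_reset (σ : Op (Qubit × Qubit)) : expect bell (reset σ) = σ.trace / 2 := by
  have h := ofReal_inv_sqrt_two_mul_self
  simp only [reset, LinearMap.add_apply, LinearMap.comp_apply, LinearMap.id_apply,
    Matrix.add_apply, expect_eq_sum, conjBy_kronecker_one_apply, conjBy_one_kronecker_apply,
    Fintype.sum_prod_type,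
    Fin.sum_univ_two, bell, Matrix.trace, Matrix.diag]
  generalize (1 / Real.sqrt 2 : ℝ) = s at h ⊢
  simp
  linear_combination (σ (0, 0) (0, 0) + σ (1, 1) (1, 1) + σ (0, 1) (0, 1) + σ (1, 0) (1, 0)) * h

/-- The filter on the first qubit whose adjoint maps the singlet to `ψ`. -/
def filterKraus (ψ : Qubit × Qubit → ℂ) : Op Qubit :=
  ((Real.sqrt 2 : ℝ) : ℂ) • !![star (ψ (0, 1)), star (ψ (1, 1)); -star (ψ (0, 0)), -star (ψ (1, 0))]

theorem filterKraus_conjTranspose_mulVec_singlet (ψ : Qubit × Qubit → ℂ) :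
    (filterKraus ψ ⊗ₖ (1 : Op Qubit))ᴴ *ᵥ singlet = ψ := by
  have h : ((Real.sqrt 2 : ℝ) : ℂ) * ((1 / Real.sqrt 2 : ℝ) : ℂ) = 1 := by
    rw [← Complex.ofReal_mul, mul_one_div_cancel (by positivity), Complex.ofReal_one]
  funext p
  obtain ⟨i, j⟩ := p
  simp only [Matrix.mulVec, dotProduct, Fintype.sum_prod_type, Fin.sum_univ_two, singlet,
    filterKraus]
  generalize (1 / Real.sqrt 2 : ℝ) = s at h ⊢
  fin_cases i <;> fin_cases j <;> simp
  · linear_combination ψ (0, 0) * h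
  · linear_combination ψ (0, 1) * h
  · linear_combination ψ (1, 0) * h
  · linear_combination ψ (1, 1) * h

theorem filterKraus_contractive {ψ : Qubit × Qubit → ℂ} (hψ : ψ ∈ filterVectors) :
    (1 - (filterKraus ψ)ᴴ * filterKraus ψ).PosSemidef := by
  refine posSemidef_of_forall_nonneg fun u => ?_
  -- The filter has ⟨u|K†K|u⟩ = 2‖c‖². Testing ψ on the product state u ⊗ c yields ‖c‖⁴ ≤
  -- ‖u‖²‖c‖²/2, and dividing by ‖c‖² gives contractivity.
  let c : Qubit → ℂ := fun j => ∑ i, u i * star (ψ (i, j))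
  have h := hψ _ (Matrix.posSemidef_vecMulVec_self_star fun p : Qubit × Qubit => u p.1 * c p.2)
  have h1 : expect ψ (partialTranspose (Matrix.vecMulVec
      (fun p : Qubit × Qubit => u p.1 * c p.2) (star fun p : Qubit × Qubit => u p.1 * c p.2))) =
      (∑ j, star (c j) * c j) * (∑ j, star (c j) * c j) := by
    simp only [expect_eq_sum, Fintype.sum_prod_type, Fin.sum_univ_two, partialTranspose_apply,
      Matrix.vecMulVec_apply, Pi.star_apply, star_mul', c, star_add, star_star]
    ring
  have h2 : (Matrix.vecMulVec (fun p : Qubit × Qubit => u p.1 * c p.2)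
      (star fun p : Qubit × Qubit => u p.1 * c p.2)).trace =
      (∑ i, star (u i) * u i) * (∑ j, star (c j) * c j) := by
    simp only [Matrix.trace, Matrix.diag, Fintype.sum_prod_type, Fin.sum_univ_two,
      Matrix.vecMulVec_apply, Pi.star_apply, star_mul']
    ring
  rw [h1, h2] at h
  have h3 : star u ⬝ᵥ ((1 - (filterKraus ψ)ᴴ * filterKraus ψ) *ᵥ u) =
      (∑ i, star (u i) * u i) - 2 * ∑ j, star (c j) * c j := by
    have hs : ((Real.sqrt 2 : ℝ) : ℂ) * ((Real.sqrt 2 : ℝ) : ℂ) = 2 := by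
      rw [← Complex.ofReal_mul, Real.mul_self_sqrt zero_le_two]
      norm_num
    rw [← expect_apply]
    simp only [expect_eq_sum, Fin.sum_univ_two, filterKraus, c, Matrix.sub_apply, Matrix.mul_apply]
    generalize Real.sqrt 2 = s at hs ⊢
    simp
    linear_combination
      -(((starRingEnd ℂ) (u 0) * ψ (0, 0) + (starRingEnd ℂ) (u 1) * ψ (1, 0)) *
          (u 0 * (starRingEnd ℂ) (ψ (0, 0)) + u 1 * (starRingEnd ℂ) (ψ (1, 0))) +
        ((starRingEnd ℂ) (u 0) * ψ (0, 1) + (starRingEnd ℂ) (u 1) * ψ (1, 1)) *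
          (u 0 * (starRingEnd ℂ) (ψ (0, 1)) + u 1 * (starRingEnd ℂ) (ψ (1, 1)))) * hs
  have hn : ∀ v : Qubit → ℂ, ∑ j, star (v j) * v j = ((∑ j, ‖v j‖ ^ 2 : ℝ) : ℂ) := fun v => by
    simp [Complex.conj_mul']
  rw [h3]
  rw [hn, hn] at h ⊢
  have h4 : 0 ≤ ∑ j, ‖c j‖ ^ 2 := Finset.sum_nonneg fun _ _ => by positivity
  have h5 : 0 ≤ ∑ j, ‖u j‖ ^ 2 := Finset.sum_nonneg fun _ _ => by positivity
  generalize ∑ j, ‖c j‖ ^ 2 = C at *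
  generalize ∑ j, ‖u j‖ ^ 2 = U at *
  have h6 : C * C ≤ U * C / 2 := by exact_mod_cast h
  have h7 : 0 ≤ U - 2 * C := by
    rcases h4.eq_or_lt with h0 | h0
    · rw [← h0]; linarith
    · nlinarith
  exact_mod_cast h7

open scoped MatrixOrder in
theorem exists_conjTranspose_mul_self_eq {n : Type} [Fintype n] [DecidableEq n] {M : Op n}
    (hM : M.PosSemidef) : ∃ D : Op n, Dᴴ * D = M := by
  obtain ⟨D, hD⟩ := CStarAlgebra.nonneg_iff_eq_star_mul_self.1 hM.nonneg
  exact ⟨D, hD.symm⟩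

/-- Each filter vector is realized by an LOCC protocol: filter the first qubit, and reset both
qubits to a product state if the filter fails. -/
theorem exists_locc_of_mem_filterVectors {ψ : Qubit × Qubit → ℂ} (hψ : ψ ∈ filterVectors) :
    ∃ Λ ∈ LOCC Qubit Qubit, ∀ σ, expect bell (Λ σ) =
      σ.trace / 2 - expect ψ (partialTranspose σ) := by
  obtain ⟨D, hD⟩ := exists_conjTranspose_mul_self_eq (filterKraus_contractive hψ)
  have hK : ∑ i : Fin 2, (![filterKraus ψ, D] i)ᴴ * ![filterKraus ψ, D] i = 1 := by
    simp [Fin.sum_univ_two, hD]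
  refine ⟨_, IsLOCC.left Qubit Qubit Qubit 2 ![filterKraus ψ, D] hK ![LinearMap.id, reset] ?_,
    fun σ => ?_⟩
  · intro i
    fin_cases i
    · exact .done
    · exact isLOCC_reset
  · have ht := trace_sum_conjBy _ (sum_kraus_kronecker_one (b := Qubit) hK) σ
    rw [Fin.sum_univ_two] at ht
    rw [Fin.sum_univ_two, LinearMap.add_apply, map_add]
    simp only [LinearMap.comp_apply, Matrix.cons_val_zero, Matrix.cons_val_one,
      LinearMap.id_apply] at ht ⊢
    -- Each branch contributes half its trace, the successful one less ⟨ψ|Γσ|ψ⟩; the two traces add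
    -- up to Tr σ.
    rw [expect_bell_reset, ← filterKraus_conjTranspose_mulVec_singlet ψ, ← expect_conjBy,
      ← partialTranspose_conjBy_kronecker_one, expect_singlet_partialTranspose,
      filterKraus_conjTranspose_mulVec_singlet]
    linear_combination ht / 2

/-- The maximal overlap is attained, and bounds the overlap of each LOCC map, rejected branches
counting `1/2`. -/
theorem exists_isGreatest_overlapValues {ρ : Op (Qubit × Qubit)} (hρ : IsDensity ρ) :
    ∃ f : ℝ, IsGreatest (overlapValues ρ) f ∧ 1 / 2 ≤ f ∧ ∀ Λ ∈ LOCC Qubit Qubit,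
      overlap (Λ ρ) + (1 - (Λ ρ).trace.re) / 2 ≤ f := by
  let g : (Qubit × Qubit → ℂ) → ℝ := fun ψ => (1 / 2 - expect ψ (partialTranspose ρ)).re
  obtain ⟨ψ, hψ, hmax⟩ := isCompact_filterVectors.exists_isMaxOn ⟨0, zero_mem_filterVectors⟩
    (f := g) (Complex.continuous_re.comp
      (continuous_const.sub (continuous_expect _))).continuousOn
  have hbound : ∀ Λ ∈ LOCC Qubit Qubit, overlap (Λ ρ) + (1 - (Λ ρ).trace.re) / 2 ≤ g ψ :=
    fun Λ hΛ => by
      obtain ⟨χ, hχ, h⟩ := exists_filterVector_bound hΛ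
      have h1 := (Complex.le_def.1 (h ρ hρ.1)).1
      rw [hρ.2] at h1
      refine le_trans (le_of_eq ?_) (h1.trans (hmax hχ))
      simp [overlap, expect_apply]
  refine ⟨g ψ, ⟨?_, ?_⟩, ?_, hbound⟩
  · obtain ⟨Λ, hΛ, h⟩ := exists_locc_of_mem_filterVectors hψ
    exact ⟨Λ, hΛ, by rw [overlap, ← expect_apply, h, hρ.2]⟩
  · rintro t ⟨Λ, hΛ, rfl⟩
    have h1 := hbound Λ hΛ
    have h2 := (Complex.le_def.1 (IsLOCC.posSemidef hΛ hρ.1).2).1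
    rw [hρ.2, Complex.one_re] at h2
    linarith
  -- The zero vector is always admissible and contributes the value 1/2.
  · have h1 := hmax zero_mem_filterVectors
    simpa [g, expect_zero_left] using h1

theorem expect_bell (σ : Op (Qubit × Qubit)) : expect bell σ =
    (σ (0, 0) (0, 0) + σ (0, 0) (1, 1) + σ (1, 1) (0, 0) + σ (1, 1) (1, 1)) / 2 := by
  have h := ofReal_inv_sqrt_two_mul_self
  simp only [expect_eq_sum, Fintype.sum_prod_type, Fin.sum_univ_two, bell]
  generalize (1 / Real.sqrt 2 : ℝ) = s at h ⊢
  simp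
  linear_combination (σ (0, 0) (0, 0) + σ (0, 0) (1, 1) + σ (1, 1) (0, 0) + σ (1, 1) (1, 1)) * h

/-- The difference is the weight on the orthogonal complement of Φ, spanned by |00⟩ - |11⟩ (of
squared norm 2), |01⟩ and |10⟩. -/
theorem expect_bell_le_trace {σ : Op (Qubit × Qubit)} (hσ : σ.PosSemidef) :
    expect bell σ ≤ σ.trace := by
  have h := expect_nonneg (fun p : Qubit × Qubit => !![1, 0; 0, -1] p.1 p.2) hσ
  have h1 : 0 ≤ σ (0, 1) (0, 1) := hσ.diag_nonneg
  have h2 : 0 ≤ σ (1, 0) (1, 0) := hσ.diag_nonneg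
  rw [← sub_nonneg]
  refine (add_nonneg (add_nonneg (div_nonneg h zero_le_two) h1) h2).trans_eq ?_
  rw [expect_bell]
  simp only [expect_eq_sum, Fintype.sum_prod_type, Fin.sum_univ_two, Matrix.trace, Matrix.diag]
  simp
  ring

/-! ### Wire maps, their Choi operators and the lower bound -/

theorem inputState_apply (φ : Op Qubit) (ρ : Op (Qubit × Qubit))
    (p q : (Qubit × Qubit) × Qubit) :
    inputState φ ρ p q = φ p.1.1 q.1.1 * ρ (p.1.2, p.2) (q.1.2, q.2) := rfl

/-- The map from `A` to `C` implemented by `V` with the resource `ρ`. -/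
def wireMap (ρ : Op (Qubit × Qubit))
    (V : SuperOp ((Qubit × Qubit) × Qubit) ((Qubit × Qubit) × Qubit)) : SuperOp Qubit Qubit where
  toFun φ := traceFst (V (inputState φ ρ))
  map_add' φ χ := by
    have : inputState (φ + χ) ρ = inputState φ ρ + inputState χ ρ := by
      ext p q
      simp [inputState_apply, add_mul]
    rw [this, map_add]
    ext i j
    simp [traceFst, Finset.sum_add_distrib]
  map_smul' c φ := by
    have : inputState (c • φ) ρ = c • inputState φ ρ := by
      ext p q
      simp [inputState_apply, mul_assoc]
    rw [this, map_smul]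
    ext i j
    simp [traceFst, Finset.mul_sum]

theorem wireMap_apply (ρ : Op (Qubit × Qubit))
    (V : SuperOp ((Qubit × Qubit) × Qubit) ((Qubit × Qubit) × Qubit)) (φ : Op Qubit) :
    wireMap ρ V φ = traceFst (V (inputState φ ρ)) := rfl

theorem wireMap_sum (ρ : Op (Qubit × Qubit)) {m : ℕ} (c : Fin m → ℂ)
    (F : Fin m → SuperOp ((Qubit × Qubit) × Qubit) ((Qubit × Qubit) × Qubit)) (φ : Op Qubit) :
    wireMap ρ (∑ i, c i • F i) φ = ∑ i, c i • wireMap ρ (F i) φ := by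
  ext x y
  simp only [wireMap_apply, traceFst, LinearMap.sum_apply, LinearMap.smul_apply, Matrix.of_apply,
    Matrix.sum_apply, Matrix.smul_apply, Finset.smul_sum]
  rw [Finset.sum_comm]

/-- A linear map that fixes all density operators is the identity. -/
theorem eq_self_of_forall_isDensity {E : SuperOp Qubit Qubit}
    (h : ∀ φ, IsDensity φ → E φ = φ) (φ : Op Qubit) : E φ = φ := by
  have hpos : ∀ M : Op Qubit, M.PosSemidef → E M = M := fun M hM => by
    by_cases h0 : M.trace = 0
    · rw [hM.trace_eq_zero_iff.1 h0, map_zero]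
    · have h1 := h (M.trace⁻¹ • M)
        ⟨hM.smul (inv_nonneg.2 hM.trace_nonneg), by simp [Matrix.trace_smul, h0]⟩
      rw [map_smul] at h1
      exact smul_right_injective _ (inv_ne_zero h0) h1
  have hv : ∀ v : Qubit → ℂ, E (Matrix.vecMulVec v (star v)) = Matrix.vecMulVec v (star v) :=
    fun v => hpos _ (Matrix.posSemidef_vecMulVec_self_star v)
  -- The projections onto |0⟩, |1⟩, |0⟩ + |1⟩ and |0⟩ + i|1⟩ span all operators; the last two supply
  -- the off-diagonal entries.
  have hd : φ = (φ 0 0 - (φ 0 1 + φ 1 0) / 2 - Complex.I * (φ 0 1 - φ 1 0) / 2) •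
        Matrix.vecMulVec ![1, 0] (star ![1, 0]) +
      (φ 1 1 - (φ 0 1 + φ 1 0) / 2 - Complex.I * (φ 0 1 - φ 1 0) / 2) •
        Matrix.vecMulVec ![0, 1] (star ![0, 1]) +
      ((φ 0 1 + φ 1 0) / 2) • Matrix.vecMulVec ![1, 1] (star ![1, 1]) +
      (Complex.I * (φ 0 1 - φ 1 0) / 2) •
        Matrix.vecMulVec ![1, Complex.I] (star ![1, Complex.I]) := by
    ext i j
    simp only [Matrix.add_apply, Matrix.smul_apply, Matrix.vecMulVec_apply, Pi.star_apply]
    fin_cases i <;> fin_cases j <;> simp <;> ring_nf <;> simp [Complex.I_sq] <;> ring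
  rw [hd]
  simp only [map_add, map_smul, hv]

/-- The isometry from `B` to `A' ⊗ (A ⊗ B)` that prepares a Bell pair on `A' ⊗ A`. -/
def bellKraus : Matrix (Qubit × (Qubit × Qubit)) Qubit ℂ :=
  Matrix.of fun p b => bell (p.1, p.2.1) * if p.2.2 = b then 1 else 0

theorem bellKraus_isometry : ∑ _i : Unit, bellKrausᴴ * bellKraus = 1 := by
  have h := ofReal_inv_sqrt_two_mul_self
  ext i j
  simp only [Finset.univ_unique, Finset.sum_const, Finset.card_singleton, one_smul,
    Matrix.mul_apply, Fintype.sum_prod_type, Fin.sum_univ_two, bellKraus, bell,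
    Matrix.conjTranspose_apply, Matrix.of_apply]
  generalize (1 / Real.sqrt 2 : ℝ) = s at h ⊢
  fin_cases i <;> fin_cases j <;> simp <;> linear_combination 2 * h

/-- The Kraus operator for the outcome `m` of a measurement of `s`, which is discarded. -/
def discardKraus (t : Type) {s : Type} [DecidableEq t] [DecidableEq s] (m : s) :
    Matrix t (t × s) ℂ :=
  Matrix.of fun i p => if p = (i, m) then 1 else 0

theorem sum_discardKraus {t s : Type} [Fintype t] [DecidableEq t] [Fintype s] [DecidableEq s] :
    ∑ m : s, (discardKraus t m)ᴴ * discardKraus t m = 1 := by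
  ext ⟨i, m⟩ ⟨j, n⟩
  simp only [Matrix.sum_apply, Matrix.mul_apply, discardKraus, Matrix.conjTranspose_apply,
    Matrix.of_apply, Prod.mk.injEq, Matrix.one_apply, ite_and, apply_ite star, star_one, star_zero,
    mul_ite, mul_one, mul_zero]
  by_cases hij : i = j <;> by_cases hmn : m = n <;> simp [hij, hmn]

/-- A protocol between `A ⊗ B` and `C` yields one between `B` and `C`, in which the first party
feeds one half of a Bell pair into `A`. -/
theorem exists_locc_choi {F : SuperOp ((Qubit × Qubit) × Qubit) ((Qubit × Qubit) × Qubit)}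
    (hF : F ∈ LOCC (Qubit × Qubit) Qubit) :
    ∃ Λ ∈ LOCC Qubit Qubit, ∀ ρ p q,
      Λ ρ p q = wireMap ρ F (Matrix.single p.1 q.1 1) p.2 q.2 / 2 := by
  have h1 := IsLOCC.left_fintype (b := Qubit) (sum_discardKraus (t := Qubit) (s := Qubit × Qubit))
    (Λ := fun _ => LinearMap.id) fun _ => .done
  have h2 := IsLOCC.left_fintype (b := Qubit) bellKraus_isometry
    (Λ := fun _ => withSpectator Qubit F) fun _ => IsLOCC.withSpectator hF Qubit
  refine ⟨_, h1.comp h2, fun ρ p q => ?_⟩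
  -- The (k, l) block of the Bell projector with respect to the reference qubit is half a matrix
  -- unit, so F acts blockwise on matrix units.
  have h3 : ∀ k l, (Matrix.of fun x y : (Qubit × Qubit) × Qubit =>
      conjBy (bellKraus ⊗ₖ (1 : Op Qubit)) ρ ((k, x.1), x.2) ((l, y.1), y.2)) =
      (1 / 2 : ℂ) • inputState (Matrix.single k l 1) ρ := fun k l => by
    have h := ofReal_inv_sqrt_two_mul_self
    ext ⟨⟨a, b⟩, c⟩ ⟨⟨a', b'⟩, c'⟩
    simp only [Matrix.of_apply, conjBy_kronecker_one_apply, bellKraus, bell, Matrix.smul_apply,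
      inputState_apply, Matrix.single_apply]
    generalize (1 / Real.sqrt 2 : ℝ) = s at h ⊢
    by_cases hk : k = a <;> by_cases hl : l = a' <;> simp [hk, hl, apply_ite]
    linear_combination ρ (b, c) (b', c') * h
  simp only [LinearMap.comp_apply, LinearMap.sum_apply, LinearMap.id_apply, Finset.univ_unique,
    Finset.sum_singleton, Matrix.sum_apply]
  rw [wireMap_apply, traceFst, Matrix.of_apply, Finset.sum_div]
  refine Finset.sum_congr rfl fun m _ => ?_
  rw [conjBy_kronecker_one_apply]
  simp only [withSpectator_apply, h3, map_smul, Matrix.smul_apply, discardKraus, Matrix.of_apply]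
  rw [Finset.sum_eq_single (p.1, m), Finset.sum_eq_single (q.1, m)]
  · simp
    ring
  · intro b _ hb
    simp [hb]
  · simp
  · intro b _ hb
    simp [hb]
  · simp

/-- Lower bound on the sampling overhead. -/
theorem le_of_mem_cutOverheads {ρ : Op (Qubit × Qubit)} (hρ : IsDensity ρ) {f : ℝ} (hf : 0 < f)
    (hf1 : f ≤ 1) (h : ∀ Λ ∈ LOCC Qubit Qubit, overlap (Λ ρ) + (1 - (Λ ρ).trace.re) / 2 ≤ f)
    {κ : ℝ} (hκ : κ ∈ cutOverheads ρ) : 2 / f - 1 ≤ κ := by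
  obtain ⟨m, c, F, V, hF, rfl, hV, rfl⟩ := hκ
  choose Λ hΛ hΛF using fun i => exists_locc_choi (hF i)
  have hid := eq_self_of_forall_isDensity (E := wireMap ρ (∑ i, (c i : ℂ) • F i)) hV
  have hentry : ∀ p q : Qubit × Qubit,
      ∑ i, (c i : ℂ) * Λ i ρ p q = Matrix.single p.1 q.1 (1 : ℂ) p.2 q.2 / 2 := fun p q => by
    rw [← hid (Matrix.single p.1 q.1 1), wireMap_sum]
    simp only [hΛF, Matrix.sum_apply, Matrix.smul_apply, smul_eq_mul, Finset.sum_div, mul_div_assoc]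
  -- By `hentry`, the weighted outputs sum to the Choi operator of the identity, |Φ⟩⟨Φ|, whose
  -- overlap and trace are both 1.
  have ho : ∑ i, c i * overlap (Λ i ρ) = 1 := by
    have : ∑ i, (c i : ℂ) * expect bell (Λ i ρ) = 1 := by
      simp only [expect_bell, mul_div_assoc', mul_add, ← Finset.sum_div, Finset.sum_add_distrib,
        hentry]
      simp
      norm_num
    have h1 := congrArg Complex.re this
    simpa [Complex.re_sum, overlap, expect_apply] using h1
  have ht : ∑ i, c i * (Λ i ρ).trace.re = 1 := by
    have : ∑ i, (c i : ℂ) * (Λ i ρ).trace = 1 := by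
      simp only [Matrix.trace, Matrix.diag, Fintype.sum_prod_type, Fin.sum_univ_two, mul_add,
        Finset.sum_add_distrib, hentry]
      simp
      norm_num
    have h1 := congrArg Complex.re this
    simpa [Complex.re_sum] using h1
  calc 2 / f - 1 = ∑ i, c i * (2 / f * overlap (Λ i ρ) - (Λ i ρ).trace.re) := by
        simp only [mul_sub, Finset.sum_sub_distrib, ht, mul_left_comm _ (2 / f), ← Finset.mul_sum,
          ho, mul_one]
    _ ≤ ∑ i, |c i| := Finset.sum_le_sum fun i _ => by
        have hp := IsLOCC.posSemidef (hΛ i) hρ.1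
        have h1 := (Complex.le_def.1 hp.2).1
        have h2 := (Complex.le_def.1 hp.1.trace_nonneg).1
        have h3 : 0 ≤ overlap (Λ i ρ) := (Complex.le_def.1 (expect_nonneg bell hp.1)).1
        have h4 := h _ (hΛ i)
        rw [hρ.2] at h1
        simp only [Complex.one_re, Complex.zero_re] at h1 h2
        refine (le_abs_self _).trans ?_
        rw [abs_mul]
        refine mul_le_of_le_one_right (abs_nonneg _) (abs_le.2 ⟨?_, ?_⟩)
        · have : 0 ≤ 2 / f * overlap (Λ i ρ) := by positivity
          linarith
        -- With t the trace, 2·overlap ≤ 2f - (1 - t) ≤ f(1 + t), the last step being (1 - f)(1 - t)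
        -- ≥ 0.
        · have : 2 / f * overlap (Λ i ρ) ≤ 1 + (Λ i ρ).trace.re := by
            rw [div_mul_eq_mul_div, div_le_iff₀ hf]
            nlinarith
          linarith

/-! ### Pauli operators and the tetrahedral twirl -/

/-- The Pauli operators. -/
def pauli : Fin 4 → Op Qubit :=
  ![1, !![0, 1; 1, 0], !![0, -Complex.I; Complex.I, 0], !![1, 0; 0, -1]]

theorem pauli_unitary (i : Fin 4) : (pauli i)ᴴ * pauli i = 1 := by
  fin_cases i <;> ext x y <;> fin_cases x <;> fin_cases y <;>
    simp [pauli, Matrix.mul_apply, Matrix.one_apply]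

theorem pauli_conjTranspose (i : Fin 4) : (pauli i)ᴴ = pauli i := by
  fin_cases i <;> ext x y <;> fin_cases x <;> fin_cases y <;> simp [pauli]

theorem sum_pauli_entries (x y z w : Qubit) :
    ∑ i, star (pauli i x y) * pauli i z w = if x = z ∧ y = w then 2 else 0 := by
  fin_cases x <;> fin_cases y <;> fin_cases z <;> fin_cases w <;>
    simp [pauli, Fin.sum_univ_four] <;> norm_num

theorem pauli_one_conj (φ : Op Qubit) :
    pauli 1 * φ * pauli 1 = !![φ 1 1, φ 1 0; φ 0 1, φ 0 0] := by
  ext x y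
  simp only [Matrix.mul_apply, Fin.sum_univ_two]
  fin_cases x <;> fin_cases y <;> simp [pauli]

theorem pauli_two_conj (φ : Op Qubit) :
    pauli 2 * φ * pauli 2 = !![φ 1 1, -φ 1 0; -φ 0 1, φ 0 0] := by
  ext x y
  simp only [Matrix.mul_apply, Fin.sum_univ_two]
  fin_cases x <;> fin_cases y <;> simp [pauli] <;> ring_nf <;> simp [Complex.I_sq]

theorem pauli_three_conj (φ : Op Qubit) :
    pauli 3 * φ * pauli 3 = !![φ 0 0, -φ 0 1; -φ 1 0, φ 1 1] := by
  ext x y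
  simp only [Matrix.mul_apply, Fin.sum_univ_two]
  fin_cases x <;> fin_cases y <;> simp [pauli]

theorem sum_pauli_conj (φ : Op Qubit) :
    pauli 1 * φ * pauli 1 + pauli 2 * φ * pauli 2 + pauli 3 * φ * pauli 3 =
      (2 * φ.trace) • 1 - φ := by
  rw [pauli_one_conj, pauli_two_conj, pauli_three_conj]
  ext x y
  fin_cases x <;> fin_cases y <;> simp [Matrix.trace, Fin.sum_univ_two] <;> ring

/-- A unitary that permutes the three Pauli axes cyclically. -/
def cyclicUnitary : Op Qubit :=
  !![(1 - Complex.I) / 2, (-1 - Complex.I) / 2; (1 - Complex.I) / 2, (1 + Complex.I) / 2]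

theorem cyclicUnitary_unitary : cyclicUnitaryᴴ * cyclicUnitary = 1 := by
  ext x y
  fin_cases x <;> fin_cases y <;> simp [cyclicUnitary, Matrix.mul_apply, map_ofNat] <;> ring_nf <;>
    simp [Complex.I_sq] <;> norm_num

theorem cyclicUnitary_mul_conjTranspose : cyclicUnitary * cyclicUnitaryᴴ = 1 :=
  mul_eq_one_comm.1 cyclicUnitary_unitary

theorem pauli_mul_cyclicUnitary :
    pauli 1 * cyclicUnitary = cyclicUnitary * pauli 3 ∧
      pauli 2 * cyclicUnitary = cyclicUnitary * pauli 1 ∧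
      pauli 3 * cyclicUnitary = cyclicUnitary * pauli 2 := by
  refine ⟨?_, ?_, ?_⟩ <;>
  · ext x y
    simp only [Matrix.mul_apply, Fin.sum_univ_two]
    fin_cases x <;> fin_cases y <;> simp [pauli, cyclicUnitary] <;> ring_nf <;>
      simp [Complex.I_sq] <;> ring

/-- The powers of the cyclic unitary, up to phases. -/
def axisRotation : Fin 3 → Op Qubit := ![1, cyclicUnitary, cyclicUnitaryᴴ]

theorem axisRotation_unitary (j : Fin 3) : (axisRotation j)ᴴ * axisRotation j = 1 := by
  fin_cases j
  · simp [axisRotation]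
  · exact cyclicUnitary_unitary
  · simpa [axisRotation] using cyclicUnitary_mul_conjTranspose

theorem axisRotation_mul_conjTranspose (j : Fin 3) : axisRotation j * (axisRotation j)ᴴ = 1 :=
  mul_eq_one_comm.1 (axisRotation_unitary j)

theorem conjTranspose_cyclicUnitary_mul_mul {P Q : Op Qubit}
    (h : P * cyclicUnitary = cyclicUnitary * Q) :
    cyclicUnitaryᴴ * P * cyclicUnitary = Q ∧ cyclicUnitary * Q * cyclicUnitaryᴴ = P := by
  constructor
  · rw [mul_assoc, h, ← mul_assoc, cyclicUnitary_unitary, one_mul]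
  · rw [← h, mul_assoc, cyclicUnitary_mul_conjTranspose, mul_one]

/-- The three rotations carry any one nontrivial Pauli operator to all three, so the sum reduces to
`sum_pauli_conj`. -/
theorem sum_axisRotation_pauli (φ : Op Qubit) {k : Fin 4} (hk : k ≠ 0) :
    ∑ j, ((axisRotation j)ᴴ * pauli k * axisRotation j) * φ *
      ((axisRotation j)ᴴ * pauli k * axisRotation j) = (2 * φ.trace) • 1 - φ := by
  obtain ⟨h1, h2, h3⟩ := pauli_mul_cyclicUnitary
  obtain ⟨h13, h31⟩ := conjTranspose_cyclicUnitary_mul_mul h1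
  obtain ⟨h21, h12⟩ := conjTranspose_cyclicUnitary_mul_mul h2
  obtain ⟨h32, h23⟩ := conjTranspose_cyclicUnitary_mul_mul h3
  rw [← sum_pauli_conj, Fin.sum_univ_three]
  have e0 : axisRotation 0 = 1 := rfl
  have e1 : axisRotation 1 = cyclicUnitary := rfl
  have e2 : axisRotation 2 = cyclicUnitaryᴴ := rfl
  rw [e0, e1, e2, Matrix.conjTranspose_conjTranspose, Matrix.conjTranspose_one, one_mul, mul_one]
  have hk' : k = 1 ∨ k = 2 ∨ k = 3 := by omega
  rcases hk' with rfl | rfl | rfl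
  · rw [h13, h12]; abel
  · rw [h21, h23]; abel
  · rw [h32, h31]; abel

/-- The set of rotations is closed under adjoints, so conjugating the other way only permutes the
summands. -/
theorem sum_axisRotation_pauli_three (φ : Op Qubit) :
    ∑ j, (axisRotation j * pauli 3 * (axisRotation j)ᴴ) * φ *
      (axisRotation j * pauli 3 * (axisRotation j)ᴴ) = (2 * φ.trace) • 1 - φ := by
  rw [← sum_axisRotation_pauli φ (k := 3) (by decide), Fin.sum_univ_three, Fin.sum_univ_three]
  simp only [axisRotation, Matrix.cons_val_zero, Matrix.cons_val_one, Matrix.cons_val,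
    Matrix.conjTranspose_conjTranspose, Matrix.conjTranspose_one]
  abel

/-- Up to normalization, the output for the outcome `Φ` of a Bell measurement on `A ⊗ B`. -/
def teleported (σ : Op (Qubit × Qubit)) (φ : Op Qubit) : Op Qubit :=
  Matrix.of fun d d' => (∑ b, ∑ b', φ b b' * σ (b, d) (b', d')) / 2

theorem teleported_apply (σ : Op (Qubit × Qubit)) (φ : Op Qubit) (d d' : Qubit) :
    teleported σ φ d d' = (∑ b, ∑ b', φ b b' * σ (b, d) (b', d')) / 2 := rfl

/-- The overlaps with the four Bell states. -/
def bellWeight (σ : Op (Qubit × Qubit)) : Fin 4 → ℂ :=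
  ![(σ (0, 0) (0, 0) + σ (0, 0) (1, 1) + σ (1, 1) (0, 0) + σ (1, 1) (1, 1)) / 2,
    (σ (0, 1) (0, 1) + σ (0, 1) (1, 0) + σ (1, 0) (0, 1) + σ (1, 0) (1, 0)) / 2,
    (σ (0, 1) (0, 1) - σ (0, 1) (1, 0) - σ (1, 0) (0, 1) + σ (1, 0) (1, 0)) / 2,
    (σ (0, 0) (0, 0) - σ (0, 0) (1, 1) - σ (1, 1) (0, 0) + σ (1, 1) (1, 1)) / 2]

/-- Standard teleportation through σ: with Pauli corrections summed over all outcomes it is a Pauli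
channel whose weights are the Bell-diagonal entries of σ. -/
theorem sum_pauli_teleported (σ : Op (Qubit × Qubit)) (φ : Op Qubit) :
    ∑ i, pauli i * teleported σ (pauli i * φ * pauli i) * pauli i =
      ∑ i, bellWeight σ i • (pauli i * φ * pauli i) := by
  have e0 : pauli 0 = 1 := rfl
  simp only [Fin.sum_univ_four, pauli_one_conj, pauli_two_conj, pauli_three_conj, e0, one_mul,
    mul_one]
  ext x y
  fin_cases x <;> fin_cases y <;> simp [teleported_apply, bellWeight, Fin.sum_univ_two] <;> ring

/-- Averaging over the rotations equalizes the three nontrivial Pauli weights, leaving only their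
sum, Tr σ minus the weight of Φ. -/
theorem sum_twirl_teleported (σ : Op (Qubit × Qubit)) (φ : Op Qubit) :
    ∑ j, ∑ i, (pauli i * axisRotation j)ᴴ *
      teleported σ (pauli i * axisRotation j * φ * (pauli i * axisRotation j)ᴴ) *
      (pauli i * axisRotation j) =
      (3 * bellWeight σ 0) • φ + (σ.trace - bellWeight σ 0) • ((2 * φ.trace) • 1 - φ) := by
  have h : ∀ j, ∑ i, (pauli i * axisRotation j)ᴴ *
      teleported σ (pauli i * axisRotation j * φ * (pauli i * axisRotation j)ᴴ) *
      (pauli i * axisRotation j) =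
      ∑ i, bellWeight σ i • (((axisRotation j)ᴴ * pauli i * axisRotation j) * φ *
        ((axisRotation j)ᴴ * pauli i * axisRotation j)) := fun j => by
    have h1 := congrArg (fun M => (axisRotation j)ᴴ * M * axisRotation j)
      (sum_pauli_teleported σ (axisRotation j * φ * (axisRotation j)ᴴ))
    simp only [Finset.mul_sum, Finset.sum_mul] at h1
    simpa only [Matrix.conjTranspose_mul, pauli_conjTranspose, Matrix.mul_assoc,
      Matrix.mul_smul, Matrix.smul_mul] using h1
  have e0 : pauli 0 = 1 := rfl
  simp only [h]
  rw [Finset.sum_comm, Fin.sum_univ_succ]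
  simp only [← Finset.smul_sum, sum_axisRotation_pauli φ (Fin.succ_ne_zero _), ← Finset.sum_smul,
    e0, mul_one, axisRotation_unitary, one_mul]
  congr 1
  · rw [Fin.sum_univ_three, mul_comm, mul_smul]
    congr 1
    module
  · congr 1
    simp [Fin.sum_univ_three, bellWeight, Matrix.trace, Fintype.sum_prod_type, Fin.sum_univ_two]
    ring

/-- Dephasing, (χ + ZχZ)/2, keeps the diagonal of χ; swapping its two entries is subtraction from Tr
χ · 1. -/
theorem sum_flip_diagonal (χ : Op Qubit) :
    ∑ b : Qubit, χ b b • Matrix.single (b + 1) (b + 1) (1 : ℂ) =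
      χ.trace • 1 - (1 / 2 : ℂ) • (χ + pauli 3 * χ * pauli 3) := by
  rw [pauli_three_conj]
  ext x y
  fin_cases x <;> fin_cases y <;>
    simp [Matrix.trace, Fin.sum_univ_two] <;> ring

/-- Measuring along one of the three axes and preparing the orthogonal state. -/
theorem sum_measure_flip (φ : Op Qubit) :
    ∑ j, ∑ b : Qubit, ((axisRotation j)ᴴ * φ * axisRotation j) b b •
      (axisRotation j * Matrix.single (b + 1) (b + 1) (1 : ℂ) * (axisRotation j)ᴴ) =
      (2 * φ.trace) • 1 - φ := by
  have h : ∀ j, ∑ b : Qubit, ((axisRotation j)ᴴ * φ * axisRotation j) b b •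
      (axisRotation j * Matrix.single (b + 1) (b + 1) (1 : ℂ) * (axisRotation j)ᴴ) =
      φ.trace • 1 - (1 / 2 : ℂ) • (φ + (axisRotation j * pauli 3 * (axisRotation j)ᴴ) * φ *
        (axisRotation j * pauli 3 * (axisRotation j)ᴴ)) := fun j => by
    have h1 := congrArg (fun M => axisRotation j * M * (axisRotation j)ᴴ)
      (sum_flip_diagonal ((axisRotation j)ᴴ * φ * axisRotation j))
    have h2 : ((axisRotation j)ᴴ * φ * axisRotation j).trace = φ.trace := by
      rw [Matrix.trace_mul_comm, ← mul_assoc, axisRotation_mul_conjTranspose, one_mul]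
    have h3 : axisRotation j * ((axisRotation j)ᴴ * φ * axisRotation j) * (axisRotation j)ᴴ = φ := by
      rw [← mul_assoc, ← mul_assoc, axisRotation_mul_conjTranspose, one_mul, mul_assoc,
        axisRotation_mul_conjTranspose, mul_one]
    simp only [h2, Finset.mul_sum, Finset.sum_mul, Matrix.mul_smul, Matrix.smul_mul, mul_sub,
      sub_mul, mul_add, add_mul, h3, mul_one, axisRotation_mul_conjTranspose] at h1
    rw [h1]
    simp only [Matrix.mul_assoc]
  simp only [h, Finset.sum_sub_distrib, ← Finset.smul_sum, Finset.sum_add_distrib,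
    sum_axisRotation_pauli_three]
  simp only [Fin.sum_univ_three]
  module

/-! ### One-way protocols: twirled teleportation and the universal NOT -/

section

variable {ι κ : Type} [Fintype ι] [Fintype κ]

/-- The protocol in which the first party measures `A ⊗ B` with effects `w i (w i)†`, discarding
its system, and the second party applies the Kraus operators `R i` for the outcome `i`. -/
def oneWay (w : ι → Qubit × Qubit → ℂ) (R : ι → κ → Op Qubit) :
    SuperOp ((Qubit × Qubit) × Qubit) ((Qubit × Qubit) × Qubit) :=
  ∑ i, (∑ k, LinearMap.id ∘ₗ conjBy ((1 : Op (Qubit × Qubit)) ⊗ₖ R i k)) ∘ₗ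
    conjBy (Matrix.vecMulVec (Pi.single (0, 0) 1) (star (w i)) ⊗ₖ (1 : Op Qubit))

theorem oneWay_mem_LOCC {w : ι → Qubit × Qubit → ℂ} {R : ι → κ → Op Qubit}
    (hw : ∑ i, Matrix.vecMulVec (w i) (star (w i)) = 1) (hR : ∀ i, ∑ k, (R i k)ᴴ * R i k = 1) :
    oneWay w R ∈ LOCC (Qubit × Qubit) Qubit := by
  refine .left_fintype ?_ fun i => .right_fintype (hR i) fun _ => .done
  rw [← hw]
  refine Finset.sum_congr rfl fun i _ => ?_
  rw [Matrix.conjTranspose_vecMulVec, star_star, Matrix.vecMulVec_mul_vecMulVec]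
  simp

/-- The unnormalized state of `C` after the effect `w w†` on `A ⊗ B`. -/
def reducedState (w : Qubit × Qubit → ℂ) (M : Op ((Qubit × Qubit) × Qubit)) : Op Qubit :=
  Matrix.of fun c d => ∑ x, ∑ y, star (w x) * M (x, c) (y, d) * w y

theorem reducedState_apply (w : Qubit × Qubit → ℂ) (M : Op ((Qubit × Qubit) × Qubit))
    (c d : Qubit) : reducedState w M c d = ∑ x, ∑ y, star (w x) * M (x, c) (y, d) * w y := rfl

theorem traceFst_oneWay (w : ι → Qubit × Qubit → ℂ) (R : ι → κ → Op Qubit)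
    (M : Op ((Qubit × Qubit) × Qubit)) :
    traceFst (oneWay w R M) = ∑ i, ∑ k, R i k * reducedState (w i) M * (R i k)ᴴ := by
  have h1 : ∀ i (x y : Qubit × Qubit) (c d : Qubit),
      conjBy (Matrix.vecMulVec (Pi.single (0, 0) 1) (star (w i)) ⊗ₖ (1 : Op Qubit)) M (x, c) (y, d)
        = if x = (0, 0) ∧ y = (0, 0) then reducedState (w i) M c d else 0 := by
    intro i x y c d
    rw [conjBy_kronecker_one_apply, reducedState_apply]
    by_cases hx : x = (0, 0) <;> by_cases hy : y = (0, 0) <;>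
      simp [hx, hy, Matrix.vecMulVec_apply]
  ext c d
  simp only [traceFst, oneWay, Matrix.of_apply, LinearMap.sum_apply, LinearMap.comp_apply,
    LinearMap.id_apply, Matrix.sum_apply]
  rw [Finset.sum_comm]
  refine Finset.sum_congr rfl fun i _ => ?_
  rw [Finset.sum_comm]
  refine Finset.sum_congr rfl fun k _ => ?_
  rw [Finset.sum_eq_single (0, 0)]
  · rw [conjBy_one_kronecker_apply]
    simp only [h1, and_self, if_true, Matrix.mul_apply, Matrix.conjTranspose_apply,
      Finset.sum_mul]
    rw [Finset.sum_comm]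
  · intro x _ hx
    rw [conjBy_one_kronecker_apply]
    simp [h1, hx, -conjBy_apply]
  · simp

end

/-- `1 / √3`. -/
def invSqrtThree : ℝ := (Real.sqrt 3)⁻¹

theorem invSqrtThree_mul_self : (invSqrtThree : ℂ) * invSqrtThree = 1 / 3 := by
  rw [← Complex.ofReal_mul, invSqrtThree, ← mul_inv, Real.mul_self_sqrt (by norm_num)]
  norm_num

/-- Teleportation from `A` through `B ⊗ C`, twirled over the tetrahedral group. -/
def teleport : SuperOp ((Qubit × Qubit) × Qubit) ((Qubit × Qubit) × Qubit) :=
  oneWay (ι := Fin 3 × Fin 4) (κ := Unit)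
    (fun i p => ((1 / Real.sqrt 2 : ℝ) : ℂ) * invSqrtThree *
      star ((pauli i.2 * axisRotation i.1) p.2 p.1))
    fun i _ => (pauli i.2 * axisRotation i.1)ᴴ

theorem sum_pauli_mul_entries {U : Op Qubit} (hU : Uᴴ * U = 1) (x y z w : Qubit) :
    ∑ i, star ((pauli i * U) x y) * (pauli i * U) z w = if x = z ∧ y = w then 2 else 0 := by
  have h1 : ∀ i, star ((pauli i * U) x y) * (pauli i * U) z w =
      ∑ k, ∑ l, star (U k y) * U l w * (star (pauli i x k) * pauli i z l) := fun i => by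
    simp only [Matrix.mul_apply, Fin.sum_univ_two, star_add, star_mul']
    ring
  have h2 := congrFun (congrFun hU y) w
  rw [Matrix.mul_apply] at h2
  simp only [Matrix.conjTranspose_apply, Matrix.one_apply] at h2
  simp only [h1]
  rw [Finset.sum_comm]
  simp only [Finset.sum_comm (γ := Fin 4), ← Finset.mul_sum, sum_pauli_entries]
  by_cases hxz : x = z
  · simp only [hxz, true_and, mul_ite, mul_zero, Finset.sum_ite_eq, Finset.mem_univ, if_true,
      ← Finset.sum_mul, h2]
    split_ifs <;> simp
  · simp [hxz]

theorem teleport_mem_LOCC : teleport ∈ LOCC (Qubit × Qubit) Qubit := by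
  refine oneWay_mem_LOCC ?_ fun i => ?_
  · have hs := ofReal_inv_sqrt_two_mul_self
    have ht := invSqrtThree_mul_self
    ext ⟨a, b⟩ ⟨a', b'⟩
    have h : ∀ j, ∑ i, star ((pauli i * axisRotation j) b a) *
        (pauli i * axisRotation j) b' a' = if b = b' ∧ a = a' then 2 else 0 :=
      fun j => sum_pauli_mul_entries (axisRotation_unitary j) b a b' a'
    simp only [Matrix.sum_apply, Matrix.vecMulVec_apply, Pi.star_apply, star_mul',
      Complex.star_def, Complex.conj_ofReal, Complex.conj_conj]
    simp only [Complex.star_def] at h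
    generalize (1 / Real.sqrt 2 : ℝ) = s at hs ⊢
    generalize invSqrtThree = t at ht ⊢
    -- For each rotation the four outcomes sum to 2 · 1; three rotations with weight 1/2 · 1/3 give
    -- the identity.
    calc _ = ∑ i : Fin 3 × Fin 4, (s * s : ℂ) * (t * t) *
          ((starRingEnd ℂ) ((pauli i.2 * axisRotation i.1) b a) *
            (pauli i.2 * axisRotation i.1) b' a') :=
          Finset.sum_congr rfl fun i _ => by ring
      _ = _ := by
          rw [← Finset.mul_sum, Fintype.sum_prod_type]
          simp only [h, hs, ht, Matrix.one_apply, Prod.mk.injEq, and_comm (a := a = a')]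
          split_ifs <;> simp
          norm_num
  · simp only [Finset.univ_unique, Finset.sum_singleton, Matrix.conjTranspose_conjTranspose]
    rw [Matrix.conjTranspose_mul, mul_assoc, ← mul_assoc (axisRotation i.1),
      axisRotation_mul_conjTranspose, one_mul, mul_eq_one_comm.1 (pauli_unitary i.2)]

theorem wireMap_teleport (σ : Op (Qubit × Qubit)) (φ : Op Qubit) :
    wireMap σ teleport φ = bellWeight σ 0 • φ +
      ((σ.trace - bellWeight σ 0) / 3) • ((2 * φ.trace) • 1 - φ) := by
  have hred : ∀ i : Fin 3 × Fin 4, reducedState (fun p => ((1 / Real.sqrt 2 : ℝ) : ℂ) *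
      invSqrtThree * star ((pauli i.2 * axisRotation i.1) p.2 p.1)) (inputState φ σ) =
      (1 / 3 : ℂ) • teleported σ
        (pauli i.2 * axisRotation i.1 * φ * (pauli i.2 * axisRotation i.1)ᴴ) := fun i => by
    have hs := ofReal_inv_sqrt_two_mul_self
    have ht := invSqrtThree_mul_self
    generalize pauli i.2 * axisRotation i.1 = W
    ext c d
    simp only [reducedState_apply, inputState_apply, Matrix.smul_apply, teleported_apply,
      Matrix.mul_apply, Matrix.conjTranspose_apply, star_mul', Complex.star_def,
      Complex.conj_ofReal, Complex.conj_conj, Fintype.sum_prod_type, Fin.sum_univ_two, smul_eq_mul]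
    generalize (1 / Real.sqrt 2 : ℝ) = s at hs ⊢
    generalize invSqrtThree = t at ht ⊢
    rw [← ht, div_eq_mul_one_div _ (2 : ℂ), ← hs]
    ring
  rw [wireMap_apply, teleport, traceFst_oneWay]
  simp only [hred, Finset.univ_unique, Finset.sum_singleton, Matrix.conjTranspose_conjTranspose,
    Matrix.mul_smul, Matrix.smul_mul, ← Finset.smul_sum]
  rw [Fintype.sum_prod_type, sum_twirl_teleported]
  module

/-- Measure `A` along one of the three axes, and prepare the orthogonal state on `C`. -/
def universalNot : SuperOp ((Qubit × Qubit) × Qubit) ((Qubit × Qubit) × Qubit) :=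
  oneWay (ι := (Fin 3 × Qubit) × Qubit) (κ := Qubit)
    (fun i p => invSqrtThree * axisRotation i.1.1 p.1 i.1.2 * if p.2 = i.2 then 1 else 0)
    fun i k => axisRotation i.1.1 * Matrix.single (i.1.2 + 1) k 1

theorem universalNot_mem_LOCC : universalNot ∈ LOCC (Qubit × Qubit) Qubit := by
  refine oneWay_mem_LOCC ?_ fun i => ?_
  · have ht := invSqrtThree_mul_self
    ext ⟨a, b⟩ ⟨a', b'⟩
    have h : ∀ j, ∑ k, axisRotation j a k * star (axisRotation j a' k) =
        (1 : Op Qubit) a a' := fun j => by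
      rw [← axisRotation_mul_conjTranspose j, Matrix.mul_apply]
      rfl
    simp only [Complex.star_def] at h
    simp only [Matrix.sum_apply, Matrix.vecMulVec_apply, Pi.star_apply, star_mul',
      Complex.star_def, Complex.conj_ofReal, Fintype.sum_prod_type]
    generalize invSqrtThree = t at ht ⊢
    by_cases hb : b = b'
    · subst hb
      calc _ = ∑ j, (t * t : ℂ) * ∑ k, axisRotation j a k *
            (starRingEnd ℂ) (axisRotation j a' k) := by
            refine Finset.sum_congr rfl fun j _ => ?_
            rw [Finset.mul_sum]
            refine Finset.sum_congr rfl fun k _ => ?_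
            rw [Finset.sum_eq_single b]
            · simp
              ring
            · intro c _ hc
              simp [Ne.symm hc]
            · simp
        _ = _ := by
            simp only [h, ht, Matrix.one_apply, Prod.mk.injEq, and_true]
            split_ifs <;> simp
    · rw [Matrix.one_apply_ne (by simp [hb])]
      refine Finset.sum_eq_zero fun j _ => Finset.sum_eq_zero fun k _ =>
        Finset.sum_eq_zero fun c _ => ?_
      by_cases hc : b = c
      · simp [← hc, Ne.symm hb]
      · simp [hc]
  · simp only [Matrix.conjTranspose_mul, mul_assoc]
    simp only [← mul_assoc (axisRotation i.1.1)ᴴ, axisRotation_unitary, one_mul]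
    exact sum_single_kraus _

/-- The resource is discarded: B is measured without using the outcome and C is overwritten, so ρ
enters only through its trace. -/
theorem wireMap_universalNot {ρ : Op (Qubit × Qubit)} (hρ : ρ.trace = 1) (φ : Op Qubit) :
    wireMap ρ universalNot φ = (1 / 3 : ℂ) • ((2 * φ.trace) • 1 - φ) := by
  have hred : ∀ j (k b c d : Qubit), reducedState
      (fun p => invSqrtThree * axisRotation j p.1 k * if p.2 = b then 1 else 0)
      (inputState φ ρ) c d = (1 / 3 : ℂ) *
        (((axisRotation j)ᴴ * φ * axisRotation j) k k * ρ (b, c) (b, d)) := fun j k b c d => by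
    have ht := invSqrtThree_mul_self
    simp only [reducedState_apply, inputState_apply, Matrix.mul_apply,
      Matrix.conjTranspose_apply, star_mul', Complex.star_def, Complex.conj_ofReal,
      Fintype.sum_prod_type, Fin.sum_univ_two]
    generalize invSqrtThree = t at ht ⊢
    rw [← ht]
    fin_cases b <;> simp <;> ring
  have hprep : ∀ (U M : Op Qubit) (t : Qubit), ∑ k, U * Matrix.single t k 1 * M *
      (U * Matrix.single t k 1)ᴴ = M.trace • (U * Matrix.single t t 1 * Uᴴ) := fun U M t => by
    have h1 : ∀ k, Matrix.single t k (1 : ℂ) * M * Matrix.single k t 1 =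
        M k k • Matrix.single t t 1 := fun k => by
      rw [Matrix.single_mul_mul_single]
      simp
    simp only [Matrix.conjTranspose_mul, Matrix.conjTranspose_single, star_one]
    calc _ = ∑ k, U * (Matrix.single t k (1 : ℂ) * M * Matrix.single k t 1) * Uᴴ :=
          Finset.sum_congr rfl fun k _ => by simp only [mul_assoc]
      _ = _ := by
          simp only [h1, Matrix.mul_smul, Matrix.smul_mul, ← Finset.sum_smul]
          rfl
  rw [wireMap_apply, universalNot, traceFst_oneWay]
  simp only [hprep]
  rw [← sum_measure_flip φ, Fintype.sum_prod_type, Fintype.sum_prod_type, Finset.smul_sum]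
  refine Finset.sum_congr rfl fun j _ => ?_
  rw [Finset.smul_sum]
  refine Finset.sum_congr rfl fun b _ => ?_
  dsimp only
  rw [← Finset.sum_smul, smul_smul]
  congr 1
  simp only [Matrix.trace, Matrix.diag, hred, ← Finset.mul_sum]
  simp only [Matrix.trace, Matrix.diag, Fintype.sum_prod_type] at hρ
  rw [hρ, mul_one]

/-! ### Preprocessing the resource and assembling the optimal decomposition -/

theorem wireMap_comp_withSpectator (ρ : Op (Qubit × Qubit))
    (V : SuperOp ((Qubit × Qubit) × Qubit) ((Qubit × Qubit) × Qubit))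
    (Λ : SuperOp (Qubit × Qubit) (Qubit × Qubit)) (φ : Op Qubit) :
    wireMap ρ (V ∘ₗ withSpectator Qubit Λ) φ = wireMap (Λ ρ) V φ := by
  rw [wireMap_apply, wireMap_apply, LinearMap.comp_apply]
  congr 2
  ext p q
  rw [withSpectator_apply]
  have : (Matrix.of fun x y : Qubit × Qubit =>
      inputState φ ρ ((p.1.1, x.1), x.2) ((q.1.1, y.1), y.2)) = φ p.1.1 q.1.1 • ρ := rfl
  rw [this, map_smul]
  rfl

/-- A resource with maximal overlap `f` yields a wire cut with overhead `2 / f - 1`. -/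
theorem mem_cutOverheads {ρ : Op (Qubit × Qubit)} (hρ : IsDensity ρ) {f : ℝ} (hf : 0 < f)
    (hf1 : f ≤ 1) {Λ : SuperOp (Qubit × Qubit) (Qubit × Qubit)} (hΛ : Λ ∈ LOCC Qubit Qubit)
    (ho : expect bell (Λ ρ) = f) (ht : (Λ ρ).trace = 1) : 2 / f - 1 ∈ cutOverheads ρ := by
  -- The coefficient 1/f normalizes the identity part f·id of teleportation; what remains is (1 -
  -- f)/f times the universal NOT, which the second term cancels.
  refine ⟨2, ![1 / f, -(1 / f - 1)], ![teleport ∘ₗ withSpectator Qubit Λ, universalNot], _, ?_,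
    rfl, ?_, ?_⟩
  · intro i
    fin_cases i
    · exact IsLOCC.comp teleport_mem_LOCC (IsLOCC.withSpectator hΛ Qubit)
    · exact universalNot_mem_LOCC
  · intro φ hφ
    have hw : bellWeight (Λ ρ) 0 = f := by
      rw [← ho, expect_bell]
      rfl
    rw [← wireMap_apply, wireMap_sum, Fin.sum_univ_two]
    simp only [Matrix.cons_val_zero, Matrix.cons_val_one]
    rw [wireMap_comp_withSpectator, wireMap_teleport, wireMap_universalNot hρ.2, hw, ht, smul_add,
      smul_smul, smul_smul, smul_smul, add_assoc, ← add_smul]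
    have hf0 : (f : ℂ) ≠ 0 := Complex.ofReal_ne_zero.2 hf.ne'
    have h1 : ((1 / f : ℝ) : ℂ) * f = 1 := by
      push_cast
      field_simp
    have h2 : ((1 / f : ℝ) : ℂ) * ((1 - f) / 3) + ((-(1 / f - 1) : ℝ) : ℂ) * (1 / 3) = 0 := by
      push_cast
      field_simp
      ring
    rw [h1, h2, one_smul, zero_smul, add_zero]
  · have h1 : 1 ≤ 1 / f := by rwa [le_div_iff₀ hf, one_mul]
    rw [Fin.sum_univ_two]
    simp only [Matrix.cons_val_zero, Matrix.cons_val_one, abs_neg]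
    rw [abs_of_nonneg (by linarith), abs_of_nonneg (by linarith)]
    ring

end WireCut

end

theorem theorem1 (ρ : WireCut.Op (WireCut.Qubit × WireCut.Qubit)) (hρ : WireCut.IsDensity ρ) :
    IsGreatest (WireCut.overlapValues ρ) (WireCut.maxOverlap ρ) ∧
    IsLeast (WireCut.cutOverheads ρ) (WireCut.optimalCutOverhead ρ) ∧
    WireCut.optimalCutOverhead ρ = 2 / WireCut.maxOverlap ρ - 1 := by
  obtain ⟨f, hgreatest, hf, hbound⟩ := WireCut.exists_isGreatest_overlapValues hρ
  obtain ⟨Λ, hΛ, hΛf⟩ := hgreatest.1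
  have hp := WireCut.IsLOCC.posSemidef hΛ hρ.1
  have hle : (Λ ρ).trace.re ≤ 1 := by
    simpa [hρ.2] using (Complex.le_def.1 hp.2).1
  -- An optimal protocol rejects nothing: replacing rejected weight by a product state would raise
  -- the overlap above f.
  have hre : (Λ ρ).trace.re = 1 := by
    have := hbound Λ hΛ
    linarith
  have ht : (Λ ρ).trace = 1 :=
    Complex.ext hre (Complex.le_def.1 hp.1.trace_nonneg).2.symm
  have ho : WireCut.expect WireCut.bell (Λ ρ) = f :=
    Complex.ext hΛf.symm (Complex.le_def.1 (WireCut.expect_nonneg _ hp.1)).2.symm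
  have hf0 : 0 < f := by linarith
  have hf1 : f ≤ 1 := by
    have := WireCut.expect_bell_le_trace hp.1
    rw [ho, ht] at this
    exact_mod_cast this
  have hmax : WireCut.maxOverlap ρ = f := hgreatest.csSup_eq
  have hleast : IsLeast (WireCut.cutOverheads ρ) (2 / f - 1) :=
    ⟨WireCut.mem_cutOverheads hρ hf0 hf1 hΛ ho ht,
      fun κ hκ => WireCut.le_of_mem_cutOverheads hρ hf0 hf1 hbound hκ⟩
  have hmin : WireCut.optimalCutOverhead ρ = 2 / f - 1 := hleast.csInf_eq
  rw [hmax, hmin]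
  exact ⟨hgreatest, hleast, rfl⟩
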